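/- Let $p\in(1,\infty)$, $K\le 0$, $N>1$, $D>0$ and $\kappa=K/(N-1)$. Set $s_\kappa(\theta)=\theta$ if $\kappa=0$ and $s_\kappa(\theta)=\sinh(\sqrt{-\kappa}\,\theta)/\sqrt{-\kappa}$ if $\kappa<0$; for $t\in[0,1]$ and $\theta\ge 0$ set $\sigma^{(t)}_\kappa(\theta)=s_\kappa(t\theta)/s_\kappa(\theta)$ if $\theta>0$ and $\sigma^{(t)}_\kappa(0)=t$. Let $\mathcal F_{K,N,D}$ be the set of non-negative integrable Borel functions $h$ on $\mathbb R$ with $\operatorname{supp}h=[0,D]$ (the closure of $\{h\ne0\}$) that are MCP$(K,N)$ densities, i.e. $$h(tx_1+(1-t)x_0)\ \ge\ \sigma^{(1-t)}_\kappa(|x_1-x_0|)^{N-1}\,h(x_0)\qquad\text{for all }x_0,x_1\in[0,D],\ t\in[0,1].$$ For $h\in\mathcal F_{K,N,D}$ the $p$-spectral gap is $$\lambda^{p,h}=\inf\left\{\frac{\int|u'|^p h\,dx}{\int|u|^p h\,dx}:\ u\ \text{Lipschitz},\ u\in L^p(h\,dx),\ \int u|u|^{p-2}h\,dx=0,\ u\not\equiv0\text{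 on }[0,D]\right\}.$$ The model density is $h_{K,N,D}(x)=s_\kappa(D-x)^{N-1}$ for $x\in[0,D/2]$ and $h_{K,N,D}(x)=s_\kappa(x)^{N-1}$ for $x\in[D/2,D]$, and $T_{K,N,D}=(\ln h_{K,N,D})'$; that is, $T_{K,N,D}(x)=c(x)$ for $x\in[D/2,D]$ and $T_{K,N,D}(x)=-c(D-x)$ for $x\in[0,D/2)$, where $c(x)=(N-1)/x$ if $K=0$ and $c(x)=\sqrt{-K(N-1)}\coth(\sqrt{-K/(N-1)}\,x)$ if $K<0$. Let $\pi_p=\int_{-1}^1(1-|t|^p)^{-1/p}\,dt$, let $\sin_p$ be the inverse of $y\mapsto\int_0^y(1-|s|^p)^{-1/p}\,ds$, $y\in[-1,1]$, on $[-\pi_p/2,\pi_p/2]$, extended by $\sin_p(t)=\sin_p(\pi_p-t)$ to $[-\pi_p/2,3\pi_p/2]$ and then $2\pi_p$-periodically, and let $\cos_p=\sin_p'$. Let $\hat\lambda^p_{K,N,D}$ be the minimal $\lambda\ge0$ for which there is a function $\varphi$ on $[0,D]$ with $$\varphi'=\Big(\frac{\lambda}{p-1}\Big)^{1/p}+\frac1{p-1}\,T_{K,N,D}\,|\cos_p(\varphi)|^{p-2}\cos_p(\varphi)\,\sin_p(\varphi)\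 \text{ on }[0,D],\qquad \varphi(0)=-\frac{\pi_p}2,\quad \varphi\Big(\frac D2\Big)=0,\quad \varphi(D)=\frac{\pi_p}2 .$$ If $h\in\mathcal F_{K,N,D}$ satisfies $\lambda^{p,h}=\hat\lambda^p_{K,N,D}$, then there is a constant $c>0$ such that $h(x)=c\,h_{K,N,D}(x)$ for all $x\in(0,D)$. -/

import Mathlib

open MeasureTheory Set

namespace MCPGap

/-- The function `s_κ` for a parameter `κ ≤ 0` (only this range is used):
`s_0(θ) = θ` and `s_κ(θ) = sinh(√(-κ) θ) / √(-κ)` for `κ < 0`. -/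
noncomputable def sK (κ θ : ℝ) : ℝ :=
  if κ = 0 then θ else Real.sinh (Real.sqrt (-κ) * θ) / Real.sqrt (-κ)

/-- The distortion coefficient `σ^{(t)}(θ)` with curvature parameter `κ ≤ 0`:
it is `t` if `κ θ² = 0`, and `sinh(t θ √(-κ)) / sinh(θ √(-κ))` if `κ θ² < 0`. -/
noncomputable def distortion (κ t θ : ℝ) : ℝ :=
  if κ * θ ^ 2 = 0 then t
  else Real.sinh (t * θ * Real.sqrt (-κ)) / Real.sinh (θ * Real.sqrt (-κ))

/-- One-dimensional `MCP(K, N)` densities for `K ≤ 0`, `N > 1`: nonnegative integrable Borel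
functions satisfying the contraction inequality between any two points of the support. A density
on the half line is regarded as a function on `ℝ`. -/
structure IsMCPDensity (K N : ℝ) (h : ℝ → ℝ) : Prop where
  measurable : Measurable h
  nonneg : ∀ x, 0 ≤ h x
  integrable : Integrable h
  contraction : ∀ x₀ ∈ tsupport h, ∀ x₁ ∈ tsupport h, ∀ t ∈ Icc (0 : ℝ) 1,
    distortion (K / (N - 1)) (1 - t) |x₁ - x₀| ^ (N - 1) * h x₀ ≤ h (t * x₁ + (1 - t) * x₀)

/-- The class `F_{K,N,D}` for `K ≤ 0`: the `MCP(K, N)` densities with support `[0, D]`. -/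
def densityClass (K N D : ℝ) : Set (ℝ → ℝ) :=
  {h | IsMCPDensity K N h ∧ tsupport h = Icc 0 D}

/-- The `p`-spectral gap `λ^{p,h}`: the infimum of `∫ |u'|^p h / ∫ |u|^p h` over the Lipschitz
functions `u` in `L^p(h)` with `∫ u |u|^{p-2} h = 0` that do not vanish identically on the
support of `h`. -/
noncomputable def spectralGap (p : ℝ) (h : ℝ → ℝ) : ℝ :=
  sInf {r | ∃ u : ℝ → ℝ, (∃ C, LipschitzWith C u) ∧
    Integrable (fun x => |u x| ^ p * h x) ∧
    ∫ x, u x * |u x| ^ (p - 2) * h x = 0 ∧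
    (∃ x ∈ tsupport h, u x ≠ 0) ∧
    r = (∫ x, |deriv u x| ^ p * h x) / ∫ x, |u x| ^ p * h x}

/-- The model density `h_{K,N,D}` on `[0, D]`, extended by zero. -/
noncomputable def modelDensity (K N D x : ℝ) : ℝ :=
  if 0 ≤ x ∧ x ≤ D / 2 then sK (K / (N - 1)) (D - x) ^ (N - 1)
  else if D / 2 ≤ x ∧ x ≤ D then sK (K / (N - 1)) x ^ (N - 1)
  else 0

/-- The logarithmic derivative of `s_{K/(N-1)}^{N-1}`, for `K ≤ 0`. -/
noncomputable def cotKN (K N x : ℝ) : ℝ :=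
  if K = 0 then (N - 1) / x
  else Real.sqrt (-K * (N - 1)) *
    (Real.cosh (Real.sqrt (-K / (N - 1)) * x) / Real.sinh (Real.sqrt (-K / (N - 1)) * x))

/-- The logarithmic derivative `T_{K,N,D}` of the model density (its value at `D / 2`, where the
model density has a corner, plays no role). -/
noncomputable def modelT (K N D x : ℝ) : ℝ :=
  if D / 2 ≤ x then cotKN K N x else -cotKN K N (D - x)

/-- `π_p = ∫_{-1}^{1} (1 - |t|^p)^{-1/p} dt`. -/
noncomputable def piP (p : ℝ) : ℝ :=
  ∫ t in (-1 : ℝ)..1, 1 / (1 - |t| ^ p) ^ (1 / p)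

/-- The function `y ↦ ∫_0^y (1 - |s|^p)^{-1/p} ds`, a bijection of `[-1, 1]` onto
`[-π_p/2, π_p/2]`. -/
noncomputable def arcsinP (p y : ℝ) : ℝ :=
  ∫ s in (0 : ℝ)..y, 1 / (1 - |s| ^ p) ^ (1 / p)

/-- `t` reduced modulo `2 π_p` to the interval `[-π_p/2, 3π_p/2)`. -/
noncomputable def reduceP (p t : ℝ) : ℝ :=
  t - 2 * piP p * (⌊(t + piP p / 2) / (2 * piP p)⌋ : ℝ)

/-- The generalized sine: the inverse of `arcsinP p` on `[-π_p/2, π_p/2]`, extended by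
`sin_p t = sin_p (π_p - t)` to `[-π_p/2, 3π_p/2]` and then `2 π_p`-periodically. -/
noncomputable def sinP (p t : ℝ) : ℝ :=
  if reduceP p t ≤ piP p / 2 then
    Function.invFunOn (arcsinP p) (Icc (-1) 1) (reduceP p t)
  else
    Function.invFunOn (arcsinP p) (Icc (-1) 1) (piP p - reduceP p t)

/-- The generalized cosine: the derivative of the generalized sine. -/
noncomputable def cosP (p t : ℝ) : ℝ := deriv (sinP p) t

/-- `φ` solves, on `[0, D]`,
`φ' = (λ/(p-1))^{1/p} + (1/(p-1)) T_{K,N,D} |cos_p φ|^{p-2} cos_p φ sin_p φ`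
with `φ(0) = -π_p/2`, `φ(D/2) = 0`, `φ(D) = π_p/2`. Here `|c|^{p-2} c` is `c^{p-1}` for `c ≥ 0`. -/
structure IsPruferSolution (p K N D lam : ℝ) (φ : ℝ → ℝ) : Prop where
  ode : ∀ x ∈ Icc (0 : ℝ) D, HasDerivWithinAt φ
    ((lam / (p - 1)) ^ (1 / p) + 1 / (p - 1) * modelT K N D x *
      (|cosP p (φ x)| ^ (p - 2) * cosP p (φ x)) * sinP p (φ x)) (Icc 0 D) x
  left : φ 0 = -(piP p / 2)
  mid : φ (D / 2) = 0
  right : φ D = piP p / 2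

/-- The number `\hat λ^p_{K,N,D}`: the least `λ ≥ 0` for which the boundary value problem for the
model density is solvable. -/
noncomputable def modelGap (p K N D : ℝ) : ℝ :=
  sInf {lam | 0 ≤ lam ∧ ∃ φ : ℝ → ℝ, IsPruferSolution p K N D lam φ}

end MCPGap

namespace MCPGap

/-! ### The generalized trigonometric functions -/

/-! Write `m` for `leftModel`, the left half of the model density. Shooting in the Prüfer equation
yields some `λ > 0` for which the boundary value problem is solvable; by definition `modelGap ≤ λ`,
and no other fact about `modelGap` is needed. Undoing the Prüfer substitution on `[0, D/2]` turns
the angle into a positive `f` with zero flux at `0`, `f(D/2) = 0` and `(m |f'|^{p-1})' = λ m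
f^{p-1}`.

The MCP inequality, applied towards the endpoint `D`, says that `h / m` is nondecreasing. Hence the
averaged flux `(1/h(s)) ∫_0^s h f^{p-1}` is at most the same quantity for `m`, so `f` is a
supersolution for the weight `h`. A Hardy-type argument (Hölder followed by Tonelli,
`halfPoincare_of_supersolution`) converts this into a Poincaré inequality on `[0, a]`, for `a ≤
D/2`, for functions vanishing at `a`. The constant is strictly larger than `λ` in two cases: when `a
< D/2` (`exists_halfPoincare_of_lt`), and when `a = D/2` and `h / m` is not constant on `(0, D/2)`
(`exists_halfPoincare_of_gain`).

Suppose `h / m` is not constant on the left half. The strict constant on `[0, D/2]` survives a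
slight dilation to `[0, a]` with `a > D/2` (`HalfPoincare.exists_longer`), while the complementary
interval `[a, D]` is shorter than `D/2` and so is strict as well, by reflection. For a test function
`u`, the two inequalities are applied to `u - u(a)`; the constraint `∫ u|u|^{p-2} h = 0` and
convexity of `|·|^p` show that subtracting the constant does not decrease the `L^p(h)` norm
(`le_spectralGap`). Thus `spectralGap > λ ≥ modelGap`, against the hypothesis. So `h` is a multiple
of the model on the left half, by reflection also on the right half, and the two constants agree at
`D/2`. -/

theorem one_le_arcsinP_integrand {p s : ℝ} (hp : 1 < p) (hs : s ∈ Ioo (-1 : ℝ) 1) :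
    1 ≤ 1 / (1 - |s| ^ p) ^ (1 / p) := by
  have h1 : |s| < 1 := abs_lt.2 hs
  have h2 : |s| ^ p < 1 := Real.rpow_lt_one (abs_nonneg s) h1 (by linarith)
  have h3 : 0 ≤ |s| ^ p := Real.rpow_nonneg (abs_nonneg s) p
  rw [le_div_iff₀ (Real.rpow_pos_of_pos (by linarith) _), one_mul]
  exact Real.rpow_le_one (by linarith) (by linarith) (by positivity)

theorem arcsinP_integrand_intervalIntegrable {p : ℝ} (hp : 1 < p) :
    IntervalIntegrable (fun s : ℝ => 1 / (1 - |s| ^ p) ^ (1 / p)) volume (-1) 1 := by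
  have hp0 : 0 < 1 / p := by positivity
  have hmeas : Measurable (fun s : ℝ => 1 / (1 - |s| ^ p) ^ (1 / p)) := by fun_prop
  have h0 : IntervalIntegrable (fun s : ℝ => s ^ (-(1 / p))) volume 1 0 :=
    intervalIntegral.intervalIntegrable_rpow' (by
      rw [neg_lt_neg_iff, div_lt_one (by linarith)]; exact hp)
  have h1 : IntervalIntegrable (fun s : ℝ => (1 - s) ^ (-(1 / p))) volume 0 1 := by
    simpa using h0.comp_sub_left 1
  have h2 : IntervalIntegrable (fun s : ℝ => 1 / (1 - |s| ^ p) ^ (1 / p)) volume 0 1 := by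
    refine h1.mono_fun hmeas.aestronglyMeasurable ?_
    refine (ae_restrict_iff' measurableSet_uIoc).2 (Filter.Eventually.of_forall fun s hs => ?_)
    rw [uIoc_of_le zero_le_one] at hs
    have hs0 : 0 < s := hs.1
    have hs1 : s ≤ 1 := hs.2
    -- Since `1 - s ≤ 1 - s ^ p`, the singularity at `1` is dominated by `(1 - s)^{-1/p}`,
    -- integrable because `1/p < 1`.
    have hsp : s ^ p ≤ s := by
      simpa using Real.rpow_le_rpow_of_exponent_ge hs0 hs1 hp.le
    beta_reduce
    rw [abs_of_pos hs0, Real.rpow_neg (by linarith), Real.norm_of_nonneg (by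
      have : 0 ≤ (1 - s ^ p) ^ (1 / p) := Real.rpow_nonneg (by linarith) _
      positivity), Real.norm_of_nonneg (by
      have : 0 ≤ (1 - s) ^ (1 / p) := Real.rpow_nonneg (by linarith) _
      positivity), one_div]
    rcases hs1.eq_or_lt with rfl | hlt
    · simp
    · exact inv_anti₀ (Real.rpow_pos_of_pos (by linarith) _)
        (Real.rpow_le_rpow (by linarith) (by linarith) hp0.le)
  have h3 := h2.comp_sub_left 0
  simp only [sub_zero, zero_sub, abs_neg] at h3
  exact h3.symm.trans h2

theorem arcsinP_integrand_intervalIntegrable_of_mem {p a b : ℝ} (hp : 1 < p)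
    (ha : a ∈ Icc (-1 : ℝ) 1) (hb : b ∈ Icc (-1 : ℝ) 1) :
    IntervalIntegrable (fun s : ℝ => 1 / (1 - |s| ^ p) ^ (1 / p)) volume a b := by
  refine (arcsinP_integrand_intervalIntegrable hp).mono_set ?_
  rw [uIcc_of_le (by norm_num : (-1 : ℝ) ≤ 1)]
  exact uIcc_subset_Icc ha hb

/-- The integrand is at least `1`, so `arcsinP` expands distances. This one bound yields
injectivity, strict monotonicity of the inverse and its Lipschitz constant `1`. -/
theorem sub_le_arcsinP_sub {p x y : ℝ} (hp : 1 < p) (hx : -1 ≤ x) (hxy : x ≤ y) (hy : y ≤ 1) :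
    y - x ≤ arcsinP p y - arcsinP p x := by
  have hi := fun {a b : ℝ} => arcsinP_integrand_intervalIntegrable_of_mem (a := a) (b := b) hp
  have hxm : x ∈ Icc (-1 : ℝ) 1 := ⟨hx, hxy.trans hy⟩
  have hym : y ∈ Icc (-1 : ℝ) 1 := ⟨hx.trans hxy, hy⟩
  have h0 : (0 : ℝ) ∈ Icc (-1 : ℝ) 1 := by norm_num
  have : arcsinP p y - arcsinP p x = ∫ s in x..y, 1 / (1 - |s| ^ p) ^ (1 / p) :=
    intervalIntegral.integral_interval_sub_left (hi h0 hym) (hi h0 hxm)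
  rw [this]
  calc y - x = ∫ s in x..y, (1 : ℝ) := by simp
    _ ≤ _ := intervalIntegral.integral_mono_on_of_le_Ioo hxy (by simp) (hi hxm hym)
      fun s hs => one_le_arcsinP_integrand hp ⟨by linarith [hs.1], by linarith [hs.2]⟩

theorem arcsinP_neg (p y : ℝ) : arcsinP p (-y) = -arcsinP p y := by
  unfold arcsinP
  have := intervalIntegral.integral_comp_neg (a := 0) (b := y)
    (fun s : ℝ => 1 / (1 - |s| ^ p) ^ (1 / p))
  simp only [abs_neg, neg_zero] at this
  rw [this, intervalIntegral.integral_symm]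

theorem arcsinP_zero (p : ℝ) : arcsinP p 0 = 0 := by simp [arcsinP]

theorem arcsinP_one {p : ℝ} (hp : 1 < p) : arcsinP p 1 = piP p / 2 := by
  have h0 : (0 : ℝ) ∈ Icc (-1 : ℝ) 1 := by norm_num
  have h1 : (1 : ℝ) ∈ Icc (-1 : ℝ) 1 := by norm_num
  have h2 : (-1 : ℝ) ∈ Icc (-1 : ℝ) 1 := by norm_num
  have hi := fun {a b : ℝ} => arcsinP_integrand_intervalIntegrable_of_mem (a := a) (b := b) hp
  have := intervalIntegral.integral_interval_sub_left (hi h0 h1) (hi h0 h2)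
  have h3 : arcsinP p 1 - arcsinP p (-1) = piP p := this
  rw [arcsinP_neg] at h3
  linarith

theorem piP_pos {p : ℝ} (hp : 1 < p) : 0 < piP p := by
  have := sub_le_arcsinP_sub hp (by norm_num : (-1 : ℝ) ≤ 0) zero_le_one le_rfl
  rw [arcsinP_one hp, arcsinP_zero] at this
  linarith

theorem continuousOn_arcsinP {p : ℝ} (hp : 1 < p) : ContinuousOn (arcsinP p) (Icc (-1) 1) := by
  have := intervalIntegral.continuousOn_primitive_interval' (μ := volume)
    (arcsinP_integrand_intervalIntegrable hp)
    (show (0 : ℝ) ∈ uIcc (-1) 1 by rw [uIcc_of_le] <;> norm_num)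
  rwa [uIcc_of_le (by norm_num : (-1 : ℝ) ≤ 1)] at this

theorem hasDerivAt_arcsinP {p y : ℝ} (hp : 1 < p) (hy : y ∈ Ioo (-1 : ℝ) 1) :
    HasDerivAt (arcsinP p) (1 / (1 - |y| ^ p) ^ (1 / p)) y := by
  have hp0 : 0 < p := by linarith
  have h1 : |y| ^ p < 1 := Real.rpow_lt_one (abs_nonneg y) (abs_lt.2 hy) hp0
  refine intervalIntegral.integral_hasDerivAt_right
    (arcsinP_integrand_intervalIntegrable_of_mem hp (by norm_num) (Ioo_subset_Icc_self hy))
    (Measurable.stronglyMeasurable (by fun_prop)).stronglyMeasurableAtFilter ?_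
  refine continuousAt_const.div ?_ (Real.rpow_pos_of_pos (by linarith) _).ne'
  refine ContinuousAt.rpow_const ?_ (Or.inl (by linarith))
  exact continuousAt_const.sub (continuousAt_id.abs.rpow_const (Or.inr hp0.le))

theorem reduceP_eq_self {p t : ℝ} (hp : 1 < p) (ht : t ∈ Icc (-(piP p / 2)) (piP p / 2)) :
    reduceP p t = t := by
  have hpi := piP_pos hp
  have : ⌊(t + piP p / 2) / (2 * piP p)⌋ = 0 := by
    rw [Int.floor_eq_zero_iff]
    refine ⟨div_nonneg (by linarith [ht.1]) (by linarith), ?_⟩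
    rw [div_lt_one (by linarith)]
    linarith [ht.2]
  simp [reduceP, this]

theorem reduceP_mem {p : ℝ} (hp : 1 < p) (t : ℝ) :
    reduceP p t ∈ Icc (-(piP p / 2)) (3 * piP p / 2) := by
  have hpi := piP_pos hp
  have h2 : 0 < 2 * piP p := by linarith
  have h1 := Int.floor_le ((t + piP p / 2) / (2 * piP p))
  have h3 := Int.lt_floor_add_one ((t + piP p / 2) / (2 * piP p))
  rw [le_div_iff₀ h2] at h1
  rw [div_lt_iff₀ h2] at h3
  unfold reduceP
  constructor <;> nlinarith

theorem mem_image_arcsinP {p t : ℝ} (hp : 1 < p) (ht : t ∈ Icc (-(piP p / 2)) (piP p / 2)) :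
    t ∈ arcsinP p '' Icc (-1) 1 := by
  refine intermediate_value_Icc (by norm_num) (continuousOn_arcsinP hp) ?_
  rwa [arcsinP_neg, arcsinP_one hp]

theorem sinP_mem {p : ℝ} (hp : 1 < p) (t : ℝ) : sinP p t ∈ Icc (-1 : ℝ) 1 := by
  have h := reduceP_mem hp t
  unfold sinP
  split_ifs with h1
  · exact Function.invFunOn_mem (mem_image_arcsinP hp ⟨h.1, h1⟩)
  · exact Function.invFunOn_mem
      (mem_image_arcsinP hp ⟨by linarith [h.2], by linarith [not_le.1 h1]⟩)

theorem arcsinP_sinP {p t : ℝ} (hp : 1 < p) (ht : t ∈ Icc (-(piP p / 2)) (piP p / 2)) :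
    arcsinP p (sinP p t) = t := by
  have h := reduceP_eq_self hp ht
  unfold sinP
  rw [h, if_pos ht.2]
  exact Function.invFunOn_eq (mem_image_arcsinP hp ht)

theorem arcsinP_injOn {p : ℝ} (hp : 1 < p) : InjOn (arcsinP p) (Icc (-1) 1) := by
  refine StrictMonoOn.injOn fun x hx y hy hxy => ?_
  linarith [sub_le_arcsinP_sub hp hx.1 hxy.le hy.2]

theorem sinP_arcsinP {p y : ℝ} (hp : 1 < p) (hy : y ∈ Icc (-1 : ℝ) 1)
    (ht : arcsinP p y ∈ Icc (-(piP p / 2)) (piP p / 2)) : sinP p (arcsinP p y) = y :=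
  arcsinP_injOn hp (sinP_mem hp _) hy (arcsinP_sinP hp ht)

theorem sinP_half_pi {p : ℝ} (hp : 1 < p) : sinP p (piP p / 2) = 1 := by
  have hpi := piP_pos hp
  have := sinP_arcsinP hp (y := 1) (by norm_num) (by rw [arcsinP_one hp]; constructor <;> linarith)
  rwa [arcsinP_one hp] at this

theorem sinP_neg {p t : ℝ} (hp : 1 < p) (ht : t ∈ Icc (-(piP p / 2)) (piP p / 2)) :
    sinP p (-t) = -sinP p t := by
  have ht' : -t ∈ Icc (-(piP p / 2)) (piP p / 2) := ⟨by linarith [ht.2], by linarith [ht.1]⟩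
  have hm := sinP_mem hp t
  refine arcsinP_injOn hp (sinP_mem hp _) ⟨by linarith [hm.2], by linarith [hm.1]⟩ ?_
  rw [arcsinP_sinP hp ht', arcsinP_neg, arcsinP_sinP hp ht]

theorem sinP_zero {p : ℝ} (hp : 1 < p) : sinP p 0 = 0 := by
  have hpi := piP_pos hp
  have := sinP_neg (t := 0) hp ⟨by linarith, by linarith⟩
  rw [neg_zero] at this
  linarith

theorem sinP_neg_half_pi {p : ℝ} (hp : 1 < p) : sinP p (-(piP p / 2)) = -1 := by
  have hpi := piP_pos hp
  rw [sinP_neg hp ⟨by linarith, le_rfl⟩, sinP_half_pi hp]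

theorem sinP_strictMonoOn {p : ℝ} (hp : 1 < p) :
    StrictMonoOn (sinP p) (Icc (-(piP p / 2)) (piP p / 2)) := by
  intro s hs t ht hst
  by_contra! hcon
  have := sub_le_arcsinP_sub hp (sinP_mem hp t).1 hcon (sinP_mem hp s).2
  rw [arcsinP_sinP hp hs, arcsinP_sinP hp ht] at this
  linarith

theorem sinP_lipschitzOn {p : ℝ} (hp : 1 < p) :
    LipschitzOnWith 1 (sinP p) (Icc (-(piP p / 2)) (piP p / 2)) := by
  refine LipschitzOnWith.of_dist_le_mul fun s hs t ht => ?_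
  wlog hst : s ≤ t generalizing s t
  · rw [dist_comm, dist_comm s]
    exact this t ht s hs (le_of_not_ge hst)
  have hS := (sinP_strictMonoOn hp).monotoneOn hs ht hst
  have := sub_le_arcsinP_sub hp (sinP_mem hp s).1 hS (sinP_mem hp t).2
  rw [arcsinP_sinP hp hs, arcsinP_sinP hp ht] at this
  rw [dist_comm, dist_comm s, Real.dist_eq, Real.dist_eq, abs_of_nonneg (by linarith),
    abs_of_nonneg (by linarith)]
  simpa using this

theorem sinP_mem_Ioo {p t : ℝ} (hp : 1 < p) (ht : t ∈ Ioo (-(piP p / 2)) (piP p / 2)) :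
    sinP p t ∈ Ioo (-1 : ℝ) 1 := by
  have hpi := piP_pos hp
  have ht' := Ioo_subset_Icc_self ht
  have h1 := sinP_strictMonoOn hp ⟨le_rfl, by linarith⟩ ht' ht.1
  have h2 := sinP_strictMonoOn hp ht' ⟨by linarith, le_rfl⟩ ht.2
  rw [sinP_neg_half_pi hp] at h1
  rw [sinP_half_pi hp] at h2
  exact ⟨h1, h2⟩

theorem hasDerivAt_sinP_aux {p t : ℝ} (hp : 1 < p) (ht : t ∈ Ioo (-(piP p / 2)) (piP p / 2)) :
    HasDerivAt (sinP p) ((1 - |sinP p t| ^ p) ^ (1 / p)) t := by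
  have hS := sinP_mem_Ioo hp ht
  have h1 : |sinP p t| ^ p < 1 :=
    Real.rpow_lt_one (abs_nonneg _) (abs_lt.2 hS) (by linarith)
  have hpos : 0 < (1 - |sinP p t| ^ p) ^ (1 / p) := Real.rpow_pos_of_pos (by linarith) _
  have hA := hasDerivAt_arcsinP hp hS
  have hnhds : Icc (-(piP p / 2)) (piP p / 2) ∈ nhds t := Icc_mem_nhds ht.1 ht.2
  have := HasDerivAt.of_local_left_inverse
    ((sinP_lipschitzOn hp).continuousOn.continuousAt hnhds) hA (by positivity)
    (Filter.mem_of_superset hnhds fun s hs => arcsinP_sinP hp hs)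
  simpa using this

theorem cosP_eq {p t : ℝ} (hp : 1 < p) (ht : t ∈ Icc (-(piP p / 2)) (piP p / 2)) :
    cosP p t = (1 - |sinP p t| ^ p) ^ (1 / p) := by
  have hp0 : p ≠ 0 := by linarith
  rcases ht.1.eq_or_lt with rfl | h1
  -- At `±π_p/2` the periodic extension need not be examined: `sin_p` attains a global extremum
  -- there, and `deriv` vanishes at an extremum whether or not the function is differentiable.
  · have : IsLocalMin (sinP p) (-(piP p / 2)) := Filter.Eventually.of_forall fun s => by
      rw [sinP_neg_half_pi hp]; exact (sinP_mem hp s).1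
    rw [cosP, this.deriv_eq_zero, sinP_neg_half_pi hp]
    simp [hp0]
  rcases ht.2.eq_or_lt with rfl | h2
  · have : IsLocalMax (sinP p) (piP p / 2) := Filter.Eventually.of_forall fun s => by
      rw [sinP_half_pi hp]; exact (sinP_mem hp s).2
    rw [cosP, this.deriv_eq_zero, sinP_half_pi hp]
    simp [hp0]
  exact (hasDerivAt_sinP_aux hp ⟨h1, h2⟩).deriv

theorem hasDerivAt_sinP {p t : ℝ} (hp : 1 < p) (ht : t ∈ Ioo (-(piP p / 2)) (piP p / 2)) :
    HasDerivAt (sinP p) (cosP p t) t := by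
  rw [cosP_eq hp (Ioo_subset_Icc_self ht)]
  exact hasDerivAt_sinP_aux hp ht

theorem abs_sinP_rpow_le_one {p : ℝ} (hp : 1 < p) (t : ℝ) : |sinP p t| ^ p ≤ 1 :=
  Real.rpow_le_one (abs_nonneg _) (abs_le.2 (sinP_mem hp t)) (by linarith)

theorem cosP_nonneg {p t : ℝ} (hp : 1 < p) (ht : t ∈ Icc (-(piP p / 2)) (piP p / 2)) :
    0 ≤ cosP p t := by
  rw [cosP_eq hp ht]
  exact Real.rpow_nonneg (by linarith [abs_sinP_rpow_le_one hp t]) _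

theorem cosP_pos {p t : ℝ} (hp : 1 < p) (ht : t ∈ Ioo (-(piP p / 2)) (piP p / 2)) :
    0 < cosP p t := by
  rw [cosP_eq hp (Ioo_subset_Icc_self ht)]
  have : |sinP p t| ^ p < 1 :=
    Real.rpow_lt_one (abs_nonneg _) (abs_lt.2 (sinP_mem_Ioo hp ht)) (by linarith)
  exact Real.rpow_pos_of_pos (by linarith) _

theorem cosP_rpow {p t : ℝ} (hp : 1 < p) (ht : t ∈ Icc (-(piP p / 2)) (piP p / 2)) :
    cosP p t ^ p = 1 - |sinP p t| ^ p := by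
  rw [cosP_eq hp ht, ← Real.rpow_mul (by linarith [abs_sinP_rpow_le_one hp t]),
    one_div_mul_cancel (by linarith), Real.rpow_one]

theorem cosP_half_pi {p : ℝ} (hp : 1 < p) : cosP p (-(piP p / 2)) = 0 := by
  have hpi := piP_pos hp
  rw [cosP_eq hp ⟨le_rfl, by linarith⟩, sinP_neg_half_pi hp]
  simp [(by linarith : p ≠ 0)]

theorem abs_cosP_rpow_mul {p t : ℝ} (hp : 1 < p) (ht : t ∈ Icc (-(piP p / 2)) (piP p / 2)) :
    |cosP p t| ^ (p - 2) * cosP p t = cosP p t ^ (p - 1) := by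
  have h := cosP_nonneg hp ht
  rw [abs_of_nonneg h]
  rcases h.eq_or_lt with h0 | h0
  · rw [← h0, mul_zero, Real.zero_rpow (by linarith)]
  · nth_rewrite 2 [← Real.rpow_one (cosP p t)]
    rw [← Real.rpow_add h0]
    ring_nf

theorem cosP_rpow_sub_one {p t : ℝ} (hp : 1 < p) (ht : t ∈ Icc (-(piP p / 2)) (piP p / 2)) :
    cosP p t ^ (p - 1) = (1 - |sinP p t| ^ p) ^ ((p - 1) / p) := by
  rw [cosP_eq hp ht, ← Real.rpow_mul (by linarith [abs_sinP_rpow_le_one hp t])]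
  ring_nf

theorem continuousOn_cosP {p : ℝ} (hp : 1 < p) :
    ContinuousOn (cosP p) (Icc (-(piP p / 2)) (piP p / 2)) := by
  have h : ContinuousOn (fun t => (1 - |sinP p t| ^ p) ^ (1 / p))
      (Icc (-(piP p / 2)) (piP p / 2)) := by
    refine (continuousOn_const.sub ((sinP_lipschitzOn hp).continuousOn.abs.rpow_const
      fun _ _ => Or.inr (by linarith))).rpow_const fun _ _ => Or.inr (by positivity)
  exact h.congr fun t ht => cosP_eq hp ht

theorem hasDerivAt_cosP_rpow {p t : ℝ} (hp : 1 < p)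
    (ht : t ∈ Ioo (-(piP p / 2)) (piP p / 2)) :
    HasDerivAt (fun t => cosP p t ^ (p - 1))
      (-(p - 1) * (|sinP p t| ^ (p - 2) * sinP p t)) t := by
  have hS := sinP_mem_Ioo hp ht
  have h1 : |sinP p t| ^ p < 1 :=
    Real.rpow_lt_one (abs_nonneg _) (abs_lt.2 hS) (by linarith)
  have hnhds : Icc (-(piP p / 2)) (piP p / 2) ∈ nhds t := Icc_mem_nhds ht.1 ht.2
  have hd := (((hasDerivAt_abs_rpow (sinP p t) hp).comp t (hasDerivAt_sinP hp ht)).const_sub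
    1).rpow_const (p := (p - 1) / p) (Or.inl (by simpa using by linarith))
  have heq : (fun t => cosP p t ^ (p - 1)) =ᶠ[nhds t]
      fun t => (1 - ((fun x => |x| ^ p) ∘ sinP p) t) ^ ((p - 1) / p) :=
    Filter.mem_of_superset hnhds fun s hs => cosP_rpow_sub_one hp hs
  refine (hd.congr_of_eventuallyEq heq).congr_deriv ?_
  have h2 : (1 - |sinP p t| ^ p) ^ ((p - 1) / p - 1) * cosP p t = 1 := by
    rw [cosP_eq hp (Ioo_subset_Icc_self ht), ← Real.rpow_add (by linarith)]
    have : (p - 1) / p - 1 + 1 / p = 0 := by field_simp; ring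
    rw [this, Real.rpow_zero]
  simp only [Function.comp]
  have hp0 : p ≠ 0 := by linarith
  calc _ = -(p * ((p - 1) / p)) * (|sinP p t| ^ (p - 2) * sinP p t) *
        ((1 - |sinP p t| ^ p) ^ ((p - 1) / p - 1) * cosP p t) := by ring
    _ = _ := by rw [h2]; field_simp

theorem continuousOn_cosP_rpow {p : ℝ} (hp : 1 < p) :
    ContinuousOn (fun t => cosP p t ^ (p - 1)) (Icc (-(piP p / 2)) (piP p / 2)) :=
  (continuousOn_cosP hp).rpow_const fun _ _ => Or.inr (by linarith)

theorem cosP_neg {p t : ℝ} (hp : 1 < p) (ht : t ∈ Icc (-(piP p / 2)) (piP p / 2)) :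
    cosP p (-t) = cosP p t := by
  rw [cosP_eq hp ht, cosP_eq hp ⟨by linarith [ht.2], by linarith [ht.1]⟩, sinP_neg hp ht, abs_neg]

theorem cosP_le_one {p t : ℝ} (hp : 1 < p) (ht : t ∈ Icc (-(piP p / 2)) (piP p / 2)) :
    cosP p t ≤ 1 := by
  rw [cosP_eq hp ht]
  have : 0 ≤ |sinP p t| ^ p := by positivity
  exact Real.rpow_le_one (by linarith [abs_sinP_rpow_le_one hp t]) (by linarith) (by positivity)

/-- For `p > 2` the function `cos_p` is not Lipschitz at `±π_p/2`, but its power `p - 1` is: the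
derivative has absolute value `(p - 1)|sin_p|^{p-1} ≤ p - 1`. This is exactly the power in the
Prüfer equation. -/
theorem cosP_rpow_lipschitzOn {p : ℝ} (hp : 1 < p) :
    LipschitzOnWith (Real.toNNReal (p - 1)) (fun t => cosP p t ^ (p - 1))
      (Icc (-(piP p / 2)) (piP p / 2)) := by
  refine LipschitzOnWith.of_dist_le_mul fun s hs t ht => ?_
  wlog hst : s < t generalizing s t
  · rcases (not_lt.1 hst).eq_or_lt with rfl | h
    · simp
    · rw [dist_comm, dist_comm s]
      exact this t ht s hs h
  obtain ⟨c, hc, hc'⟩ := exists_hasDerivAt_eq_slope (fun t => cosP p t ^ (p - 1)) _ hst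
    ((continuousOn_cosP_rpow hp).mono (Icc_subset_Icc hs.1 ht.2))
    (fun x hx => hasDerivAt_cosP_rpow hp ⟨by linarith [hs.1, hx.1], by linarith [ht.2, hx.2]⟩)
  have hb : |-(p - 1) * (|sinP p c| ^ (p - 2) * sinP p c)| ≤ p - 1 := by
    have h1 : |sinP p c| ≤ 1 := abs_le.2 (sinP_mem hp c)
    have h2 : |sinP p c| ^ (p - 2) * |sinP p c| ≤ 1 := by
      rcases (abs_nonneg (sinP p c)).eq_or_lt with h0 | h0
      · rw [← h0]; simp
      · nth_rewrite 2 [← Real.rpow_one |sinP p c|]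
        rw [← Real.rpow_add h0]
        exact Real.rpow_le_one h0.le h1 (by linarith)
    rw [abs_mul, abs_neg, abs_of_pos (by linarith : 0 < p - 1), abs_mul,
      abs_of_nonneg (by positivity : 0 ≤ |sinP p c| ^ (p - 2))]
    nlinarith
  rw [hc', abs_div, abs_of_pos (by linarith : 0 < t - s), div_le_iff₀ (by linarith)] at hb
  rw [dist_comm, dist_comm s, Real.dist_eq, Real.dist_eq, Real.coe_toNNReal _ (by linarith),
    abs_of_pos (by linarith : 0 < t - s)]
  exact hb

/-! ### Existence of the Prüfer angle of the model -/

/-- The right-hand side is bounded by `|α| + M B`, so a ball of radius `(|α| + M B) D` contains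
every trajectory and Picard–Lindelöf holds on all of `[0, D]` at once. The initial condition sits at
the midpoint, which makes the symmetry argument for the boundary values possible. -/
theorem exists_trajectory {D α B M : ℝ} (hD : 0 < D) {T G : ℝ → ℝ} {L : NNReal}
    (hT : ContinuousOn T (Icc 0 D)) (hTM : ∀ x ∈ Icc 0 D, |T x| ≤ M)
    (hG : LipschitzWith L G) (hGB : ∀ y, |G y| ≤ B) :
    ∃ φ : ℝ → ℝ, φ (D / 2) = 0 ∧
      ∀ x ∈ Icc 0 D, HasDerivWithinAt φ (α + T x * G (φ x)) (Icc 0 D) x := by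
  have hM : 0 ≤ M := (abs_nonneg _).trans (hTM 0 ⟨le_rfl, hD.le⟩)
  have hB : 0 ≤ B := (abs_nonneg _).trans (hGB 0)
  have hmem : D / 2 ∈ Icc 0 D := ⟨by linarith, by linarith⟩
  have hpl : IsPicardLindelof (fun t y => α + T t * G y) (⟨D / 2, hmem⟩ : Icc 0 D) 0
      (Real.toNNReal ((|α| + M * B) * D)) 0 (Real.toNNReal (|α| + M * B))
      (Real.toNNReal M * L) := by
    refine ⟨fun t ht => ?_, fun y _ => ?_, fun t ht y _ => ?_, ?_⟩
    · refine LipschitzWith.lipschitzOnWith (LipschitzWith.of_dist_le_mul fun y z => ?_)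
      have h1 := hG.dist_le_mul y z
      rw [Real.dist_eq] at h1 ⊢
      rw [show α + T t * G y - (α + T t * G z) = T t * (G y - G z) by ring, abs_mul,
        NNReal.coe_mul, Real.coe_toNNReal _ hM, mul_assoc]
      exact mul_le_mul (hTM t ht) h1 (abs_nonneg _) hM
    · exact continuousOn_const.add (hT.mul continuousOn_const)
    · rw [Real.coe_toNNReal _ (by positivity), Real.norm_eq_abs]
      refine (abs_add_le _ _).trans (add_le_add le_rfl ?_)
      rw [abs_mul]
      exact mul_le_mul (hTM t ht) (hGB y) (abs_nonneg _) hM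
    · rw [Real.coe_toNNReal _ (by positivity), Real.coe_toNNReal _ (by positivity)]
      simp only [NNReal.coe_zero, sub_zero]
      refine mul_le_mul_of_nonneg_left ?_ (by positivity)
      exact max_le (by linarith) (by linarith)
  exact hpl.exists_eq_forall_mem_Icc_hasDerivWithinAt₀

theorem dist_trajectory_le {a b α β M : ℝ} {T G : ℝ → ℝ} {L : NNReal}
    (hTM : ∀ x ∈ Icc a b, |T x| ≤ M) (hG : LipschitzWith L G)
    {φ ψ : ℝ → ℝ}
    (hφ : ∀ x ∈ Icc a b, HasDerivWithinAt φ (α + T x * G (φ x)) (Icc a b) x)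
    (hψ : ∀ x ∈ Icc a b, HasDerivWithinAt ψ (β + T x * G (ψ x)) (Icc a b) x)
    (h0 : φ a = ψ a) (hM : 0 ≤ M) :
    ∀ x ∈ Icc a b, dist (φ x) (ψ x) ≤ gronwallBound 0 (M * L) (dist β α) (x - a) := by
  have hv : ∀ t ∈ Ico a b, LipschitzOnWith (Real.toNNReal M * L)
      (fun y => α + T t * G y) univ := by
    intro t ht
    refine LipschitzWith.lipschitzOnWith (LipschitzWith.of_dist_le_mul fun y z => ?_)
    have h1 := hG.dist_le_mul y z
    rw [Real.dist_eq] at h1 ⊢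
    rw [show α + T t * G y - (α + T t * G z) = T t * (G y - G z) by ring, abs_mul,
      NNReal.coe_mul, Real.coe_toNNReal _ hM, mul_assoc]
    exact mul_le_mul (hTM t (Ico_subset_Icc_self ht)) h1 (abs_nonneg _) hM
  have key := dist_le_of_approx_trajectories_ODE_of_mem (v := fun t y => α + T t * G y)
    (s := fun _ => univ) (K := Real.toNNReal M * L) (f := φ) (g := ψ) (δ := 0) (εf := 0)
    (εg := dist β α) hv
    (fun x hx => (hφ x hx).continuousWithinAt)
    (fun t ht => (hφ t (Ico_subset_Icc_self ht)).mono_of_mem_nhdsWithin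
      (Icc_mem_nhdsGE_of_mem ht))
    (fun t _ => (dist_self _).le) (fun _ _ => trivial)
    (fun x hx => (hψ x hx).continuousWithinAt)
    (fun t ht => (hψ t (Ico_subset_Icc_self ht)).mono_of_mem_nhdsWithin
      (Icc_mem_nhdsGE_of_mem ht))
    (fun t _ => by simp [Real.dist_eq]) (fun _ _ => trivial)
    (by rw [h0, dist_self])
  simpa [Real.coe_toNNReal _ hM] using key

/-- The shooting parameter is `α`. The value at `D` depends continuously on `α` by Grönwall, is `0`
for `α = 0` because `G 0 = 0`, and reaches `b` for large `α`. The value at `0` then comes for free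
from oddness about `D/2`. -/
theorem exists_shooting {D B b : ℝ} (hD : 0 < D) (hb : 0 < b) {T G : ℝ → ℝ} {L : NNReal}
    (hT : ContinuousOn T (Icc 0 D)) (hT0 : ∀ x ∈ Icc 0 D, 0 ≤ T x)
    (hTs : ∀ x ∈ Icc 0 D, T (D - x) = T x)
    (hG : LipschitzWith L G) (hG0 : ∀ y, 0 ≤ G y) (hGB : ∀ y, G y ≤ B) (hGe : ∀ y, G (-y) = G y)
    (hGz : G 0 = 0) :
    ∃ α > 0, ∃ φ : ℝ → ℝ, φ 0 = -b ∧ φ (D / 2) = 0 ∧ φ D = b ∧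
      ∀ x ∈ Icc 0 D, HasDerivWithinAt φ (α + T x * G (φ x)) (Icc 0 D) x := by
  obtain ⟨M, hTM⟩ := isCompact_Icc.exists_bound_of_continuousOn hT
  simp only [Real.norm_eq_abs] at hTM
  have hM : 0 ≤ M := (abs_nonneg _).trans (hTM 0 ⟨le_rfl, hD.le⟩)
  have hGB' : ∀ y, |G y| ≤ B := fun y => by rw [abs_of_nonneg (hG0 y)]; exact hGB y
  choose Φ hΦ0 hΦ using fun α => exists_trajectory (α := α) hD hT hTM hG hGB'
  have hsub : Icc (D / 2) D ⊆ Icc 0 D := Icc_subset_Icc_left (by linarith)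
  have hTM' : ∀ x ∈ Icc (D / 2) D, |T x| ≤ M := fun x hx => hTM x (hsub hx)
  have hDm : D ∈ Icc (D / 2) D := ⟨by linarith, le_rfl⟩
  have hcont : Continuous fun α => Φ α D := by
    refine continuous_iff_continuousAt.2 fun α => ?_
    have hb : ∀ β, dist (Φ β D) (Φ α D) ≤ gronwallBound 0 (M * L) (dist α β) (D - D / 2) :=
      fun β => dist_trajectory_le hTM' hG (fun x hx => (hΦ β x (hsub hx)).mono hsub)
        (fun x hx => (hΦ α x (hsub hx)).mono hsub) (by rw [hΦ0, hΦ0]) hM D hDm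
    refine tendsto_iff_dist_tendsto_zero.2 (squeeze_zero (fun _ => dist_nonneg) hb ?_)
    have h1 : Continuous fun β => gronwallBound 0 (M * L) (dist α β) (D - D / 2) :=
      (gronwallBound_continuous_ε 0 (M * L) (D - D / 2)).comp (continuous_const.dist continuous_id)
    have h2 := h1.tendsto α
    simp only [dist_self, gronwallBound_ε0_δ0] at h2
    exact h2
  have hzero : Φ 0 D = 0 := by
    have := dist_trajectory_le (α := 0) (β := 0) (ψ := fun _ => 0) hTM' hG
      (fun x hx => (hΦ 0 x (hsub hx)).mono hsub)
      (fun x _ => by simpa [hGz] using hasDerivWithinAt_const x (Icc (D / 2) D) (0 : ℝ))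
      (by rw [hΦ0]) hM D hDm
    simpa [gronwallBound_ε0_δ0] using this
  -- Since `T G ≥ 0`, the slope is at least `α = 2b/D`, and the half interval has length `D/2`.
  have hlarge : b ≤ Φ (2 * b / D) D := by
    obtain ⟨c, hc, hc'⟩ := exists_hasDerivAt_eq_slope (Φ (2 * b / D)) _
      (by linarith : D / 2 < D)
      (fun x hx => ((hΦ (2 * b / D) x (hsub hx)).mono hsub).continuousWithinAt)
      (fun x hx => (hΦ (2 * b / D) x (hsub (Ioo_subset_Icc_self hx))).hasDerivAt
        (Icc_mem_nhds (by linarith [hx.1]) hx.2))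
    rw [hΦ0, eq_div_iff (by linarith), sub_zero] at hc'
    rw [← hc']
    have h1 : 0 ≤ T c * G (Φ (2 * b / D) c) :=
      mul_nonneg (hT0 c (hsub (Ioo_subset_Icc_self hc))) (hG0 _)
    have h2 : 2 * b / D * (D - D / 2) = b := by field_simp; ring
    nlinarith
  obtain ⟨α, hα, hαb⟩ := intermediate_value_Icc (by positivity : (0 : ℝ) ≤ 2 * b / D)
    hcont.continuousOn ⟨by rw [hzero]; exact hb.le, hlarge⟩
  have hα0 : 0 < α := by
    refine hα.1.lt_of_ne ?_
    rintro rfl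
    simp only [hzero] at hαb
    exact hb.ne hαb
  -- Symmetry of `T` and evenness of `G` make `x ↦ -Φ(D - x)` a solution of the same equation with
  -- the same midpoint value; forward uniqueness on `[D/2, D]` is enough to compare the two at `D`.
  have hneg : ∀ x ∈ Icc 0 D, HasDerivWithinAt (fun x => -Φ α (D - x))
      (α + T x * G (-Φ α (D - x))) (Icc 0 D) x := by
    intro x hx
    have hx' : D - x ∈ Icc 0 D := ⟨by linarith [hx.2], by linarith [hx.1]⟩
    have h1 := (hΦ α (D - x) hx').comp x
      ((hasDerivAt_id x).const_sub D).hasDerivWithinAt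
      (fun y hy => ⟨by linarith [hy.2], by linarith [hy.1]⟩ : MapsTo _ (Icc 0 D) (Icc 0 D))
    refine h1.neg.congr_deriv ?_
    rw [hGe, hTs x hx]
    ring
  have hodd : Φ α D = -Φ α (D - D) := by
    have := dist_trajectory_le hTM' hG (fun x hx => (hΦ α x (hsub hx)).mono hsub)
      (fun x hx => (hneg x (hsub hx)).mono hsub)
      (by simp [hΦ0, show D - D / 2 = D / 2 by ring]) hM D hDm
    rw [dist_self, gronwallBound_ε0_δ0] at this
    exact dist_le_zero.1 this
  refine ⟨α, hα0, Φ α, ?_, hΦ0 α, hαb, hΦ α⟩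
  rw [sub_self] at hodd
  simp only at hαb
  linarith

/-! ### The model coefficients -/

theorem sK_pos {κ x : ℝ} (hκ : κ ≤ 0) (hx : 0 < x) : 0 < sK κ x := by
  unfold sK
  split_ifs with h
  · exact hx
  · have : 0 < Real.sqrt (-κ) := Real.sqrt_pos.2 (neg_pos.2 (lt_of_le_of_ne hκ h))
    exact div_pos (Real.sinh_pos_iff.2 (by positivity)) this

theorem continuous_sK (κ : ℝ) : Continuous (sK κ) := by
  unfold sK
  split_ifs
  · exact continuous_id
  · exact (Real.continuous_sinh.comp (continuous_const.mul continuous_id)).div_const _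

theorem hasDerivAt_sK_rpow {K N x : ℝ} (hK : K ≤ 0) (hN : 1 < N) (hx : 0 < x) :
    HasDerivAt (fun x => sK (K / (N - 1)) x ^ (N - 1))
      (cotKN K N x * sK (K / (N - 1)) x ^ (N - 1)) x := by
  have hN1 : 0 < N - 1 := by linarith
  have hκ : K / (N - 1) ≤ 0 := div_nonpos_of_nonpos_of_nonneg hK hN1.le
  have hpos := sK_pos hκ hx
  have hsplit : sK (K / (N - 1)) x ^ (N - 1) =
      sK (K / (N - 1)) x ^ (N - 1 - 1) * sK (K / (N - 1)) x := by
    rw [Real.rpow_sub_one hpos.ne' (N - 1), div_mul_cancel₀ _ hpos.ne']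
  rw [hsplit]
  by_cases h0 : K = 0
  · subst h0
    have hs : sK (0 / (N - 1)) = fun x => x := by ext; simp [sK]
    simp only [hs, cotKN, if_pos]
    refine (Real.hasDerivAt_rpow_const (Or.inl hx.ne')).congr_deriv ?_
    field_simp
  · have hκ' : K / (N - 1) ≠ 0 := div_ne_zero h0 hN1.ne'
    have hKneg : K < 0 := lt_of_le_of_ne hK h0
    set r := Real.sqrt (-K / (N - 1)) with hr
    have hrpos : 0 < r := Real.sqrt_pos.2 (div_pos (by linarith) hN1)
    have hs : sK (K / (N - 1)) = fun x => Real.sinh (r * x) / r := by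
      ext; rw [sK, if_neg hκ', hr, neg_div]
    have hsx : 0 < Real.sinh (r * x) := Real.sinh_pos_iff.2 (by positivity)
    have hd : HasDerivAt (fun x => Real.sinh (r * x) / r) (Real.cosh (r * x)) x := by
      refine (((Real.hasDerivAt_sinh (r * x)).comp x
        ((hasDerivAt_id x).const_mul r)).div_const r).congr_deriv ?_
      field_simp
    have hsq : Real.sqrt (-K * (N - 1)) = (N - 1) * r := by
      rw [hr, show -K * (N - 1) = (N - 1) ^ 2 * (-K / (N - 1)) by field_simp,
        Real.sqrt_mul (by positivity), Real.sqrt_sq hN1.le]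
    simp only [hs, cotKN, if_neg h0, hsq, ← hr]
    clear_value r
    refine (hd.rpow_const (p := N - 1) (Or.inl (by positivity))).congr_deriv ?_
    field_simp

theorem continuousOn_cotKN {K N : ℝ} (hK : K ≤ 0) (hN : 1 < N) :
    ContinuousOn (cotKN K N) (Ioi 0) := by
  unfold cotKN
  split_ifs with h0
  · exact continuousOn_const.div continuousOn_id fun x hx => (ne_of_gt hx)
  · have hr : 0 < Real.sqrt (-K / (N - 1)) := Real.sqrt_pos.2
      (div_pos (neg_pos.2 (lt_of_le_of_ne hK h0)) (by linarith))
    refine continuousOn_const.mul (ContinuousOn.div (by fun_prop) (by fun_prop) fun x hx => ?_)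
    exact (Real.sinh_pos_iff.2 (mul_pos hr hx)).ne'

theorem cotKN_nonneg {K N x : ℝ} (hN : 1 < N) (hx : 0 < x) : 0 ≤ cotKN K N x := by
  unfold cotKN
  split_ifs with h0
  · exact div_nonneg (by linarith) hx.le
  · refine mul_nonneg (Real.sqrt_nonneg _) (div_nonneg (Real.cosh_pos _).le ?_)
    exact Real.sinh_nonneg_iff.2 (by positivity)

/-- The nonlinearity of the Prüfer equation, with the angle truncated to `[-π_p/2, π_p/2]` and
with `|sin_p|` in place of `sin_p`. -/
noncomputable def pruferField (p y : ℝ) : ℝ :=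
  1 / (p - 1) * (cosP p (max (-(piP p / 2)) (min y (piP p / 2))) ^ (p - 1) *
    |sinP p (max (-(piP p / 2)) (min y (piP p / 2)))|)

theorem clamp_mem {b : ℝ} (hb : 0 ≤ b) (y : ℝ) : max (-b) (min y b) ∈ Icc (-b) b :=
  ⟨le_max_left _ _, max_le (by linarith) (min_le_right _ _)⟩

theorem pruferField_nonneg {p : ℝ} (hp : 1 < p) (y : ℝ) : 0 ≤ pruferField p y := by
  have := cosP_nonneg hp (clamp_mem (b := piP p / 2) (by linarith [piP_pos hp]) y)
  have h1 : 0 < p - 1 := by linarith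
  unfold pruferField
  positivity

theorem pruferField_le {p : ℝ} (hp : 1 < p) (y : ℝ) : pruferField p y ≤ 1 / (p - 1) := by
  have hm := clamp_mem (b := piP p / 2) (by linarith [piP_pos hp]) y
  have h1 : 0 < p - 1 := by linarith
  unfold pruferField
  refine mul_le_of_le_one_right (by positivity) (mul_le_one₀ ?_ (abs_nonneg _)
    (abs_le.2 (sinP_mem hp _)))
  exact Real.rpow_le_one (cosP_nonneg hp hm) (cosP_le_one hp hm) h1.le

theorem pruferField_neg {p : ℝ} (hp : 1 < p) (y : ℝ) : pruferField p (-y) = pruferField p y := by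
  have hb : 0 ≤ piP p / 2 := by linarith [piP_pos hp]
  have hm := clamp_mem hb y
  have h : max (-(piP p / 2)) (min (-y) (piP p / 2)) =
      -max (-(piP p / 2)) (min y (piP p / 2)) := by
    rcases le_total y (piP p / 2) with h1 | h1 <;> rcases le_total (-y) (piP p / 2) with h2 | h2 <;>
    simp only [min_eq_left, min_eq_right, h1, h2]
    · rw [max_eq_right (by linarith), max_eq_right (by linarith)]
    · rw [max_eq_right (by linarith), max_eq_left (by linarith), neg_neg]
    · rw [max_eq_left (by linarith), max_eq_right (by linarith)]
    · rw [max_eq_right (by linarith)]; linarith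
  unfold pruferField
  rw [h, cosP_neg hp hm, sinP_neg hp hm, abs_neg]

theorem pruferField_of_mem {p y : ℝ} (hy : y ∈ Icc (-(piP p / 2)) (piP p / 2)) :
    pruferField p y = 1 / (p - 1) * (cosP p y ^ (p - 1) * |sinP p y|) := by
  unfold pruferField
  rw [min_eq_left hy.2, max_eq_right hy.1]

theorem pruferField_zero {p : ℝ} (hp : 1 < p) : pruferField p 0 = 0 := by
  have := piP_pos hp
  rw [pruferField_of_mem ⟨by linarith, by linarith⟩, sinP_zero hp]
  simp

theorem pruferField_lipschitz {p : ℝ} (hp : 1 < p) :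
    LipschitzWith (Real.toNNReal (1 / (p - 1) * p)) (pruferField p) := by
  have hb : 0 ≤ piP p / 2 := by linarith [piP_pos hp]
  have h1 : 0 < p - 1 := by linarith
  refine LipschitzWith.of_dist_le_mul fun y z => ?_
  have hy := clamp_mem hb y
  have hz := clamp_mem hb z
  rw [Real.coe_toNNReal _ (by positivity), mul_assoc]
  unfold pruferField
  have hcl : |max (-(piP p / 2)) (min y (piP p / 2)) - max (-(piP p / 2)) (min z (piP p / 2))|
      ≤ |y - z| := by
    rw [max_comm, max_comm (-(piP p / 2))]
    exact (abs_max_sub_max_le_abs _ _ _).trans (abs_inf_sub_inf_le_abs _ _ _)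
  set a := max (-(piP p / 2)) (min y (piP p / 2))
  set b := max (-(piP p / 2)) (min z (piP p / 2))
  have hE := (cosP_rpow_lipschitzOn hp).dist_le_mul a hy b hz
  have hS := (sinP_lipschitzOn hp).dist_le_mul a hy b hz
  rw [Real.dist_eq, Real.dist_eq, Real.coe_toNNReal _ h1.le] at hE
  rw [Real.dist_eq, Real.dist_eq, NNReal.coe_one, one_mul] at hS
  have hS' : |(|sinP p a| - |sinP p b|)| ≤ |a - b| := (abs_abs_sub_abs_le _ _).trans hS
  have hSa : |sinP p a| ≤ 1 := abs_le.2 (sinP_mem hp a)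
  have hEb0 : 0 ≤ cosP p b ^ (p - 1) := Real.rpow_nonneg (cosP_nonneg hp hz) _
  have hEb : cosP p b ^ (p - 1) ≤ 1 :=
    Real.rpow_le_one (cosP_nonneg hp hz) (cosP_le_one hp hz) h1.le
  rw [Real.dist_eq, Real.dist_eq, ← mul_sub, abs_mul, abs_of_pos (by positivity : 0 < 1 / (p - 1))]
  refine mul_le_mul_of_nonneg_left ?_ (by positivity)
  rw [show cosP p a ^ (p - 1) * |sinP p a| - cosP p b ^ (p - 1) * |sinP p b| =
    (cosP p a ^ (p - 1) - cosP p b ^ (p - 1)) * |sinP p a| +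
    cosP p b ^ (p - 1) * (|sinP p a| - |sinP p b|) by ring]
  refine (abs_add_le _ _).trans ?_
  rw [abs_mul, abs_mul, abs_abs, abs_of_nonneg hEb0]
  have e1 : |cosP p a ^ (p - 1) - cosP p b ^ (p - 1)| * |sinP p a| ≤ (p - 1) * |a - b| :=
    (mul_le_of_le_one_right (abs_nonneg _) hSa).trans hE
  have e2 : cosP p b ^ (p - 1) * |(|sinP p a| - |sinP p b|)| ≤ |a - b| :=
    (mul_le_of_le_one_left (abs_nonneg _) hEb).trans hS'
  nlinarith

/-- Solvability of the Prüfer boundary value problem, with monotonicity of the solution. -/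
theorem exists_pruferSolution {p K N D : ℝ} (hp : 1 < p) (hK : K ≤ 0) (hN : 1 < N) (hD : 0 < D) :
    ∃ α > 0, ∃ φ : ℝ → ℝ, IsPruferSolution p K N D ((p - 1) * α ^ p) φ ∧
      StrictMonoOn φ (Icc 0 D) ∧
      ∀ x ∈ Ioo 0 (D / 2), HasDerivAt φ
        (α + 1 / (p - 1) * (-cotKN K N (D - x)) * (cosP p (φ x) ^ (p - 1) * sinP p (φ x))) x := by
  have hpi := piP_pos hp
  have h1 : 0 < p - 1 := by linarith
  have harg : ∀ x, 0 < D / 2 + |x - D / 2| := fun x => by positivity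
  have hTc : Continuous fun x => cotKN K N (D / 2 + |x - D / 2|) :=
    (continuousOn_cotKN hK hN).comp_continuous (by fun_prop) fun x => harg x
  -- `modelT` jumps at `D/2`, but it changes sign there together with `sin_p φ`. Their product
  -- therefore equals the product of a continuous even coefficient with `|sin_p φ|`, to which
  -- shooting applies. The resulting `φ` is increasing, so it stays in `[-π_p/2, π_p/2]` and the
  -- truncation is inactive.
  obtain ⟨α, hα, φ, hφ0, hφm, hφD, hφ⟩ := exists_shooting (T := fun x =>
      cotKN K N (D / 2 + |x - D / 2|)) (G := pruferField p) hD (half_pos hpi) hTc.continuousOn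
    (fun x _ => cotKN_nonneg hN (harg x))
    (fun x _ => by
      rw [show D - x - D / 2 = -(x - D / 2) by ring, abs_neg])
    (pruferField_lipschitz hp) (pruferField_nonneg hp) (pruferField_le hp) (pruferField_neg hp)
    (pruferField_zero hp)
  have hcont : ContinuousOn φ (Icc 0 D) := fun x hx => (hφ x hx).continuousWithinAt
  have hmono : StrictMonoOn φ (Icc 0 D) := by
    refine strictMonoOn_of_deriv_pos (convex_Icc 0 D) hcont fun x hx => ?_
    rw [interior_Icc] at hx
    rw [((hφ x (Ioo_subset_Icc_self hx)).hasDerivAt (Icc_mem_nhds hx.1 hx.2)).deriv]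
    have := mul_nonneg (cotKN_nonneg (K := K) hN (harg x)) (pruferField_nonneg hp (φ x))
    linarith
  have hmid : D / 2 ∈ Icc 0 D := ⟨by linarith, by linarith⟩
  have hrange : ∀ x ∈ Icc 0 D, φ x ∈ Icc (-(piP p / 2)) (piP p / 2) := fun x hx =>
    ⟨hφ0 ▸ hmono.monotoneOn ⟨le_rfl, hD.le⟩ hx hx.1,
      hφD ▸ hmono.monotoneOn hx ⟨hD.le, le_rfl⟩ hx.2⟩
  have hfield : ∀ x ∈ Icc 0 D, α + cotKN K N (D / 2 + |x - D / 2|) * pruferField p (φ x) =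
      α + 1 / (p - 1) * modelT K N D x * (cosP p (φ x) ^ (p - 1) * sinP p (φ x)) := by
    intro x hx
    rw [pruferField_of_mem (hrange x hx)]
    unfold modelT
    split_ifs with hx2
    · have : 0 ≤ sinP p (φ x) := by
        rw [← sinP_zero hp]
        refine (sinP_strictMonoOn hp).monotoneOn ⟨by linarith, by linarith⟩ (hrange x hx) ?_
        rw [← hφm]
        exact hmono.monotoneOn hmid hx hx2
      rw [abs_of_nonneg this, abs_of_nonneg (by linarith)]
      ring_nf
    · have : sinP p (φ x) ≤ 0 := by
        rw [← sinP_zero hp]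
        refine (sinP_strictMonoOn hp).monotoneOn (hrange x hx) ⟨by linarith, by linarith⟩ ?_
        rw [← hφm]
        exact hmono.monotoneOn hx hmid (not_le.1 hx2).le
      rw [abs_of_nonpos this, abs_of_nonpos (by linarith [not_le.1 hx2]),
        show D / 2 + -(x - D / 2) = D - x by ring]
      ring
  have hlam : ((p - 1) * α ^ p / (p - 1)) ^ (1 / p) = α := by
    rw [mul_div_cancel_left₀ _ h1.ne', ← Real.rpow_mul hα.le, mul_one_div_cancel (by linarith),
      Real.rpow_one]
  refine ⟨α, hα, φ, ⟨fun x hx => ?_, hφ0, hφm, hφD⟩, hmono, fun x hx => ?_⟩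
  · refine (hφ x hx).congr_deriv ?_
    rw [hlam, abs_cosP_rpow_mul hp (hrange x hx), hfield x hx]
    ring
  · have hx' : x ∈ Icc 0 D := ⟨hx.1.le, by linarith [hx.2]⟩
    refine ((hφ x hx').hasDerivAt (Icc_mem_nhds hx.1 (by linarith [hx.2]))).congr_deriv ?_
    rw [hfield x hx', modelT, if_neg (not_le.2 hx.2)]

/-! ### The model eigenfunction on a half interval -/

/-- The averaged flux `(1 / k(s)) ∫_0^s k f^{p-1}`. -/
noncomputable def meanFlux (p : ℝ) (k f : ℝ → ℝ) (s : ℝ) : ℝ :=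
  (∫ t in (0 : ℝ)..s, k t * f t ^ (p - 1)) / k s

/-- The left half of the model density, continued to `(-∞, D)`. -/
noncomputable def leftModel (K N D x : ℝ) : ℝ := sK (K / (N - 1)) (D - x) ^ (N - 1)

theorem leftModel_pos {K N D x : ℝ} (hK : K ≤ 0) (hN : 1 < N) (hx : x < D) :
    0 < leftModel K N D x :=
  Real.rpow_pos_of_pos (sK_pos (div_nonpos_of_nonpos_of_nonneg hK (by linarith))
    (by linarith)) _

theorem continuous_leftModel {K N D : ℝ} (hN : 1 < N) : Continuous (leftModel K N D) :=
  ((continuous_sK _).comp (continuous_const.sub continuous_id)).rpow_const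
    fun _ => Or.inr (by linarith)

theorem hasDerivAt_leftModel {K N D x : ℝ} (hK : K ≤ 0) (hN : 1 < N) (hx : x < D) :
    HasDerivAt (leftModel K N D) (-cotKN K N (D - x) * leftModel K N D x) x := by
  refine ((hasDerivAt_sK_rpow hK hN (by linarith : 0 < D - x)).comp x
    ((hasDerivAt_id x).const_sub D)).congr_deriv ?_
  simp only [leftModel]
  ring

/-- The first mixed (Neumann at `0`, Dirichlet at `D / 2`) eigenfunction of the model density,
obtained from the Prüfer angle. -/
theorem exists_model_eigenfunction {p K N D : ℝ} (hp : 1 < p) (hK : K ≤ 0) (hN : 1 < N)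
    (hD : 0 < D) :
    ∃ lam > 0, (∃ φ, IsPruferSolution p K N D lam φ) ∧
      ∃ f : ℝ → ℝ, ContinuousOn f (Icc 0 (D / 2)) ∧ (∀ x ∈ Ico 0 (D / 2), 0 < f x) ∧
        ∀ x ∈ Icc 0 (D / 2), f x =
          ∫ s in x..(D / 2), (lam * meanFlux p (leftModel K N D) f s) ^ (1 / (p - 1)) := by
  obtain ⟨α, hα, φ, hφ, hmono, hder⟩ := exists_pruferSolution hp hK hN hD
  have hp1 : 0 < p - 1 := by linarith
  have hpi := piP_pos hp
  have hL : 0 < D / 2 := by linarith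
  have hLD : Icc 0 (D / 2) ⊆ Icc 0 D := Icc_subset_Icc_right (by linarith)
  have hlam : 0 < (p - 1) * α ^ p := by positivity
  refine ⟨_, hlam, ⟨φ, hφ⟩, ?_⟩
  set m := leftModel K N D with hm
  have hmpos : ∀ x ∈ Icc 0 (D / 2), 0 < m x := fun x hx => leftModel_pos hK hN (by linarith [hx.2])
  have hφle : ∀ x ∈ Icc 0 (D / 2), φ x ∈ Icc (-(piP p / 2)) 0 := fun x hx =>
    ⟨hφ.left ▸ hmono.monotoneOn ⟨le_rfl, hD.le⟩ (hLD hx) hx.1,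
      hφ.mid ▸ hmono.monotoneOn (hLD hx) (hLD ⟨hL.le, le_rfl⟩) hx.2⟩
  have hφm : ∀ x ∈ Icc 0 (D / 2), φ x ∈ Icc (-(piP p / 2)) (piP p / 2) := fun x hx =>
    ⟨(hφle x hx).1, (hφle x hx).2.trans (by linarith)⟩
  have hφI : ∀ x ∈ Ioo 0 (D / 2), φ x ∈ Ioo (-(piP p / 2)) (piP p / 2) := fun x hx =>
    ⟨hφ.left ▸ hmono ⟨le_rfl, hD.le⟩ (hLD (Ioo_subset_Icc_self hx)) hx.1,
      (hφle x (Ioo_subset_Icc_self hx)).2.trans_lt (by linarith)⟩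
  have hSneg : ∀ x ∈ Ico 0 (D / 2), sinP p (φ x) < 0 := fun x hx => by
    rw [← sinP_zero hp]
    refine sinP_strictMonoOn hp (hφm x (Ico_subset_Icc_self hx)) ⟨by linarith, by linarith⟩ ?_
    rw [← hφ.mid]
    exact hmono (hLD (Ico_subset_Icc_self hx)) (hLD ⟨hL.le, le_rfl⟩) hx.2
  have hφc : ContinuousOn φ (Icc 0 (D / 2)) := fun x hx =>
    ((hφ.ode x (hLD hx)).mono hLD).continuousWithinAt
  have hCc : ContinuousOn (fun x => cosP p (φ x)) (Icc 0 (D / 2)) :=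
    (continuousOn_cosP hp).comp hφc hφm
  have hSc : ContinuousOn (fun x => sinP p (φ x)) (Icc 0 (D / 2)) :=
    (sinP_lipschitzOn hp).continuousOn.comp hφc hφm
  have hTc : ContinuousOn (fun x => -cotKN K N (D - x)) (Icc 0 (D / 2)) :=
    ((continuousOn_cotKN hK hN).comp (continuous_const.sub continuous_id).continuousOn
      fun x hx => (show 0 < D - x by linarith [hx.2])).neg
  have hJc : ContinuousOn (fun x => -cotKN K N (D - x) * cosP p (φ x) ^ p) (Icc 0 (D / 2)) :=
    hTc.mul (hCc.rpow_const fun _ _ => Or.inr (by linarith))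
  -- The Prüfer amplitude `r` is forced: `(r sin_p φ)' = α r cos_p φ` holds exactly when `r'/r = -T
  -- cos_p(φ)^p / (p - 1)`, so `r = exp(-J / (p - 1))`.
  obtain ⟨J, hJdef⟩ : ∃ J : ℝ → ℝ, J = fun x =>
    ∫ t in (0 : ℝ)..x, -cotKN K N (D - t) * cosP p (φ t) ^ p := ⟨_, rfl⟩
  have hJcont : ContinuousOn J (Icc 0 (D / 2)) := by
    have := intervalIntegral.continuousOn_primitive_interval (μ := volume)
      (hJc.integrableOn_Icc.mono_set (uIcc_of_le hL.le).le)
    rwa [uIcc_of_le hL.le, ← hJdef] at this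
  have hJd : ∀ x ∈ Ioo 0 (D / 2),
      HasDerivAt J (-cotKN K N (D - x) * cosP p (φ x) ^ p) x := by
    intro x hx
    rw [hJdef]
    have hnh : Icc 0 (D / 2) ∈ nhds x := Icc_mem_nhds hx.1 hx.2
    refine intervalIntegral.integral_hasDerivAt_right
      ((hJc.mono (Icc_subset_Icc_right hx.2.le)).intervalIntegrable_of_Icc hx.1.le) ?_
      (hJc.continuousAt hnh)
    exact hJc.stronglyMeasurableAtFilter_nhdsWithin measurableSet_Icc x |>.filter_mono
      (le_of_eq (nhdsWithin_eq_nhds.2 hnh).symm)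
  obtain ⟨r, hr⟩ : ∃ r : ℝ → ℝ, r = fun x => Real.exp (-J x / (p - 1)) := ⟨_, rfl⟩
  have hrpos : ∀ x, 0 < r x := fun x => by rw [hr]; exact Real.exp_pos _
  have hrc : ContinuousOn r (Icc 0 (D / 2)) := by
    rw [hr]; exact (hJcont.neg.div_const _).rexp
  have hrpow : ∀ x, r x ^ (p - 1) = Real.exp (-J x) := fun x => by
    rw [hr]
    simp only
    rw [← Real.exp_mul, div_mul_cancel₀ _ hp1.ne']
  have hrd : ∀ x ∈ Ioo 0 (D / 2), HasDerivAt r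
      (r x * (-(-cotKN K N (D - x) * cosP p (φ x) ^ p) / (p - 1))) x := fun x hx => by
    rw [hr]; exact ((hJd x hx).neg.div_const (p - 1)).exp
  obtain ⟨f, hf⟩ : ∃ f : ℝ → ℝ, f = fun x => -(r x * sinP p (φ x)) := ⟨_, rfl⟩
  have hfc : ContinuousOn f (Icc 0 (D / 2)) := by rw [hf]; exact (hrc.mul hSc).neg
  have hfpos : ∀ x ∈ Ico 0 (D / 2), 0 < f x := fun x hx => by
    rw [hf]; exact neg_pos.2 (mul_neg_of_pos_of_neg (hrpos x) (hSneg x hx))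
  have hfd : ∀ x ∈ Ioo 0 (D / 2), HasDerivAt f (-(α * r x * cosP p (φ x))) x := by
    intro x hx
    have hS := (hasDerivAt_sinP hp (hφI x hx)).comp x (hder x hx)
    rw [hf]
    refine ((hrd x hx).mul hS).neg.congr_deriv ?_
    have hC : cosP p (φ x) ^ p = cosP p (φ x) ^ (p - 1) * cosP p (φ x) := by
      rw [Real.rpow_sub_one (cosP_pos hp (hφI x hx)).ne', div_mul_cancel₀]
      exact (cosP_pos hp (hφI x hx)).ne'
    rw [hC]
    simp only [Function.comp]
    field_simp
    ring
  have hfint : ∀ x ∈ Icc 0 (D / 2), f x = ∫ s in x..(D / 2), α * r s * cosP p (φ s) := by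
    intro x hx
    have hsub : Icc x (D / 2) ⊆ Icc 0 (D / 2) := Icc_subset_Icc_left hx.1
    have hc : ContinuousOn (fun s => α * r s * cosP p (φ s)) (Icc x (D / 2)) :=
      ((continuousOn_const.mul hrc).mul hCc).mono hsub
    have := intervalIntegral.integral_eq_sub_of_hasDerivAt_of_le hx.2 (hfc.mono hsub)
      (fun y hy => hfd y ⟨hx.1.trans_lt hy.1, hy.2⟩)
      (hc.neg.intervalIntegrable_of_Icc hx.2)
    rw [intervalIntegral.integral_neg] at this
    have h0 : f (D / 2) = 0 := by rw [hf]; simp [hφ.mid, sinP_zero hp]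
    linarith
  -- The right-hand side is the flux `m (α r cos_p φ)^{p-1} = m |f'|^{p-1}`. It vanishes at `0`,
  -- where `φ = -π_p/2`, and its derivative is `λ m f^{p-1}`.
  have hYint : ∀ s ∈ Icc 0 (D / 2), (p - 1) * α ^ p * ∫ t in (0 : ℝ)..s, m t * f t ^ (p - 1) =
      α ^ (p - 1) * Real.exp (-J s) * cosP p (φ s) ^ (p - 1) * m s := by
    intro s hs
    have hsub : Icc 0 s ⊆ Icc 0 (D / 2) := Icc_subset_Icc_right hs.2
    have hmc : ContinuousOn m (Icc 0 (D / 2)) := (continuous_leftModel hN).continuousOn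
    have hE : ContinuousOn (fun x => cosP p (φ x) ^ (p - 1)) (Icc 0 (D / 2)) :=
      hCc.rpow_const fun _ _ => Or.inr hp1.le
    have hYc : ContinuousOn (fun x => α ^ (p - 1) * Real.exp (-J x) * cosP p (φ x) ^ (p - 1) * m x)
        (Icc 0 (D / 2)) :=
      ((continuousOn_const.mul hJcont.neg.rexp).mul hE).mul hmc
    have hdc : ContinuousOn (fun t => m t * f t ^ (p - 1)) (Icc 0 (D / 2)) :=
      hmc.mul (hfc.rpow_const fun _ _ => Or.inr hp1.le)
    have key := intervalIntegral.integral_eq_sub_of_hasDerivAt_of_le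
      (f' := fun t => (p - 1) * α ^ p * (m t * f t ^ (p - 1))) hs.1 (hYc.mono hsub)
      (fun x hx => ?_)
      (((continuousOn_const.mul hdc).mono hsub).intervalIntegrable_of_Icc hs.1)
    · rw [intervalIntegral.integral_const_mul] at key
      rw [key, hφ.left, cosP_half_pi hp, Real.zero_rpow hp1.ne']
      ring
    · have hx' : x ∈ Ioo 0 (D / 2) := ⟨hx.1, hx.2.trans_le hs.2⟩
      have hS0 := hSneg x ⟨hx'.1.le, hx'.2⟩
      have hEd := (hasDerivAt_cosP_rpow hp (hφI x hx')).comp x (hder x hx')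
      have hmd := hasDerivAt_leftModel (D := D) hK hN (by linarith [hx'.2] : x < D)
      refine ((((hJd x hx').neg.exp.const_mul (α ^ (p - 1))).mul hEd).mul hmd).congr_deriv ?_
      have hfx : f x ^ (p - 1) = Real.exp (-J x) * |sinP p (φ x)| ^ (p - 1) := by
        rw [← hrpow, ← Real.mul_rpow (hrpos x).le (abs_nonneg _), abs_of_neg hS0, hf]
        ring_nf
      have hαp : α ^ p = α ^ (p - 1) * α := by
        rw [Real.rpow_sub_one hα.ne', div_mul_cancel₀ _ hα.ne']
      have hS1 : |sinP p (φ x)| ^ (p - 1) = -(|sinP p (φ x)| ^ (p - 2) * sinP p (φ x)) := by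
        rw [show p - 1 = p - 2 + 1 by ring, Real.rpow_add_one (abs_pos.2 hS0.ne).ne']
        nth_rewrite 2 [abs_of_neg hS0]
        ring
      have hS2 : cosP p (φ x) ^ p = 1 - |sinP p (φ x)| ^ (p - 2) * sinP p (φ x) ^ 2 := by
        rw [cosP_rpow hp (hφm x (Ioo_subset_Icc_self hx')), ← sq_abs (sinP p (φ x)),
          ← Real.rpow_natCast, ← Real.rpow_add (abs_pos.2 hS0.ne)]
        norm_num
      rw [hfx, hS1, hαp, hS2]
      simp only [Function.comp, ← hm, Pi.mul_apply, Pi.neg_apply]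
      field_simp
      ring
  refine ⟨f, hfc, hfpos, fun x hx => ?_⟩
  rw [hfint x hx]
  refine intervalIntegral.integral_congr fun s hs => ?_
  rw [uIcc_of_le hx.2] at hs
  have hs' : s ∈ Icc 0 (D / 2) := ⟨hx.1.trans hs.1, hs.2⟩
  have hC := cosP_nonneg hp (hφm s hs')
  simp only [meanFlux]
  rw [← mul_div_assoc, hYint s hs', mul_div_cancel_right₀ _ (hmpos s hs').ne', ← hrpow,
    ← Real.mul_rpow hα.le (hrpos s).le, ← Real.mul_rpow (by have := hrpos s; positivity) hC,
    ← Real.rpow_mul (by have := hrpos s; positivity), mul_one_div_cancel hp1.ne', Real.rpow_one]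

/-! ### A weighted Hardy inequality -/

/-- The Poincaré inequality with constant `μ` on `[0, a]`, weight `k`, for Lipschitz functions
vanishing at `a`. -/
def HalfPoincare (p a μ : ℝ) (k : ℝ → ℝ) : Prop :=
  ∀ u : ℝ → ℝ, (∃ C, LipschitzWith C u) → u a = 0 →
    μ * ∫ x in (0 : ℝ)..a, |u x| ^ p * k x ≤ ∫ x in (0 : ℝ)..a, |deriv u x| ^ p * k x

theorem integral_deriv_of_lipschitz {u : ℝ → ℝ} {C : NNReal} (hu : LipschitzWith C u) (a b : ℝ) :
    ∫ x in a..b, deriv u x = u b - u a :=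
  (hu.lipschitzOnWith).absolutelyContinuousOnInterval.integral_deriv_eq_sub

theorem intervalIntegrable_deriv_rpow_mul {p a b : ℝ} {u k : ℝ → ℝ} {C : NNReal} (hp : 0 ≤ p)
    (hu : LipschitzWith C u) (hk : IntervalIntegrable k volume a b) :
    IntervalIntegrable (fun x => |deriv u x| ^ p * k x) volume a b := by
  have hb : ∀ x, ‖|deriv u x| ^ p‖ ≤ (C : ℝ) ^ p := fun x => by
    rw [Real.norm_of_nonneg (by positivity)]
    exact Real.rpow_le_rpow (abs_nonneg _) (norm_deriv_le_of_lipschitz hu) hp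
  have hm : Measurable fun x => |deriv u x| ^ p :=
    ((measurable_deriv u).norm).pow_const p
  exact ⟨hk.1.bdd_mul hm.aestronglyMeasurable (Filter.Eventually.of_forall hb),
    hk.2.bdd_mul hm.aestronglyMeasurable (Filter.Eventually.of_forall hb)⟩

theorem intervalIntegrable_rpow_mul {p a b : ℝ} {u k : ℝ → ℝ} (hp : 0 ≤ p)
    (hu : Continuous u) (hk : IntervalIntegrable k volume a b) :
    IntervalIntegrable (fun x => |u x| ^ p * k x) volume a b :=
  hk.continuousOn_mul (hu.abs.rpow_const fun _ => Or.inr hp).continuousOn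

/-- Hölder's inequality for the increment of a Lipschitz function, with a weight `θ`. -/
theorem enorm_rpow_le_of_lipschitz {p x a : ℝ} {u θ : ℝ → ℝ} {C : NNReal} (hp : 1 < p)
    (hx : x ≤ a) (hu : LipschitzWith C u) (hua : u a = 0)
    (hθ : IntegrableOn θ (Ioo x a)) (hθpos : ∀ s ∈ Ioo x a, 0 < θ s) :
    ENNReal.ofReal (|u x| ^ p) ≤
      (∫⁻ s in Ioo x a, ENNReal.ofReal (|deriv u s| ^ p * θ s ^ (-(p - 1)))) *
        ENNReal.ofReal ((∫ s in x..a, θ s) ^ (p - 1)) := by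
  have hp0 : 0 < p := by linarith
  have hp1 : 0 < p - 1 := by linarith
  set ν := volume.restrict (Ioo x a) with hν
  have hθm : AEMeasurable θ ν := hθ.aestronglyMeasurable.aemeasurable
  have hθae : ∀ᵐ s ∂ν, 0 < θ s := (ae_restrict_iff' measurableSet_Ioo).2
    (Filter.Eventually.of_forall hθpos)
  have hdm : Measurable (deriv u) := measurable_deriv u
  -- Hölder for the factorization `|u'| = F H` with `H = θ^{(p-1)/p}`. Extended nonnegative
  -- integrals are used because `|u'|^p θ^{-(p-1)}` need not be integrable.
  set F : ℝ → ENNReal := fun s => ENNReal.ofReal (|deriv u s| * θ s ^ (-((p - 1) / p))) with hF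
  set H : ℝ → ENNReal := fun s => ENNReal.ofReal (θ s ^ ((p - 1) / p)) with hH
  have hFm : AEMeasurable F ν := (hdm.norm.aemeasurable.mul (hθm.pow_const _)).ennreal_ofReal
  have hHm : AEMeasurable H ν := (hθm.pow_const _).ennreal_ofReal
  have hconj : p.HolderConjugate (p / (p - 1)) := Real.HolderConjugate.conjExponent hp
  have h1 : ENNReal.ofReal |u x| ≤ ∫⁻ s, (F * H) s ∂ν := by
    have e1 : |u x| = |∫ s in x..a, deriv u s| := by
      rw [integral_deriv_of_lipschitz hu, hua, zero_sub, abs_neg]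
    rw [e1, intervalIntegral.integral_of_le hx, integral_Ioc_eq_integral_Ioo, ← Real.norm_eq_abs,
      ofReal_norm]
    refine (enorm_integral_le_lintegral_enorm _).trans (lintegral_mono_ae ?_)
    filter_upwards [hθae] with s hs
    rw [Pi.mul_apply, hF, hH]
    beta_reduce
    rw [← ENNReal.ofReal_mul (by positivity), mul_assoc, ← Real.rpow_add hs, neg_add_cancel,
      Real.rpow_zero, mul_one, ← Real.norm_eq_abs, ofReal_norm]
  have h2 := h1.trans (ENNReal.lintegral_mul_le_Lp_mul_Lq ν hconj hFm hHm)
  have hFp : ∫⁻ s, F s ^ p ∂ν = ∫⁻ s in Ioo x a,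
      ENNReal.ofReal (|deriv u s| ^ p * θ s ^ (-(p - 1))) := by
    refine lintegral_congr_ae ?_
    filter_upwards [hθae] with s hs
    rw [hF]
    beta_reduce
    rw [ENNReal.ofReal_rpow_of_nonneg (by positivity) hp0.le, Real.mul_rpow (abs_nonneg _)
      (by positivity), ← Real.rpow_mul hs.le, neg_mul, div_mul_cancel₀ _ hp0.ne']
  have hHq : ∫⁻ s, H s ^ (p / (p - 1)) ∂ν = ENNReal.ofReal (∫ s in x..a, θ s) := by
    rw [intervalIntegral.integral_of_le hx, integral_Ioc_eq_integral_Ioo,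
      ofReal_integral_eq_lintegral_ofReal hθ (hθae.mono fun s hs => hs.le)]
    refine lintegral_congr_ae ?_
    filter_upwards [hθae] with s hs
    rw [hH]
    beta_reduce
    rw [ENNReal.ofReal_rpow_of_nonneg (by positivity) (by positivity), ← Real.rpow_mul hs.le,
      div_mul_div_comm, mul_comm (p - 1), div_self (by positivity), Real.rpow_one]
  rw [hFp, hHq] at h2
  have hV0 : 0 ≤ ∫ s in x..a, θ s := by
    rw [intervalIntegral.integral_of_le hx, integral_Ioc_eq_integral_Ioo]
    exact setIntegral_nonneg measurableSet_Ioo fun s hs => (hθpos s hs).le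
  have h3 := ENNReal.rpow_le_rpow h2 hp0.le
  rw [ENNReal.ofReal_rpow_of_nonneg (abs_nonneg _) hp0.le, ENNReal.mul_rpow_of_nonneg _ _ hp0.le,
    ← ENNReal.rpow_mul, ← ENNReal.rpow_mul, one_div_mul_cancel hp0.ne', ENNReal.rpow_one,
    one_div_div, div_mul_cancel₀ _ hp0.ne', ENNReal.ofReal_rpow_of_nonneg hV0 hp1.le] at h3
  exact h3

/-- Tonelli on the triangle `0 < x < s < a`. -/
theorem lintegral_triangle_swap {a : ℝ} {g W : ℝ → ENNReal}
    (hg : AEMeasurable g (volume.restrict (Ioo 0 a)))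
    (hW : AEMeasurable W (volume.restrict (Ioo 0 a))) :
    ∫⁻ x in Ioo 0 a, g x * ∫⁻ s in Ioo x a, W s =
      ∫⁻ s in Ioo 0 a, W s * ∫⁻ x in Ioo 0 s, g x := by
  have hsm : MeasurableSet {q : ℝ × ℝ | q.1 < q.2} := measurableSet_lt measurable_fst measurable_snd
  have hmeas : AEMeasurable (Function.uncurry fun x s =>
      {q : ℝ × ℝ | q.1 < q.2}.indicator (fun q => g q.1 * W q.2) (x, s))
      ((volume.restrict (Ioo 0 a)).prod (volume.restrict (Ioo 0 a))) :=
    (hg.comp_fst.mul hW.comp_snd).indicator hsm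
  have key := lintegral_lintegral_swap hmeas
  have e1 : ∀ x ∈ Ioo 0 a, ∫⁻ s in Ioo 0 a,
      {q : ℝ × ℝ | q.1 < q.2}.indicator (fun q => g q.1 * W q.2) (x, s) =
      g x * ∫⁻ s in Ioo x a, W s := by
    intro x hx
    have : (fun s => {q : ℝ × ℝ | q.1 < q.2}.indicator (fun q => g q.1 * W q.2) (x, s)) =
        (Ioi x).indicator fun s => g x * W s := by
      ext s; by_cases h : x < s <;> simp [h]
    rw [this, lintegral_indicator measurableSet_Ioi, Measure.restrict_restrict measurableSet_Ioi,
      show Ioi x ∩ Ioo 0 a = Ioo x a by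
        ext s; simp only [mem_inter_iff, mem_Ioi, mem_Ioo]
        exact ⟨fun h => ⟨h.1, h.2.2⟩, fun h => ⟨h.1, hx.1.trans h.1, h.2⟩⟩]
    exact lintegral_const_mul'' _ (hW.mono_measure (Measure.restrict_mono
      (Ioo_subset_Ioo_left hx.1.le) le_rfl))
  have e2 : ∀ s ∈ Ioo 0 a, ∫⁻ x in Ioo 0 a,
      {q : ℝ × ℝ | q.1 < q.2}.indicator (fun q => g q.1 * W q.2) (x, s) =
      W s * ∫⁻ x in Ioo 0 s, g x := by
    intro s hs
    have : (fun x => {q : ℝ × ℝ | q.1 < q.2}.indicator (fun q => g q.1 * W q.2) (x, s)) =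
        (Iio s).indicator fun x => W s * g x := by
      ext x; by_cases h : x < s <;> simp [h, mul_comm]
    rw [this, lintegral_indicator measurableSet_Iio, Measure.restrict_restrict measurableSet_Iio,
      show Iio s ∩ Ioo 0 a = Ioo 0 s by
        ext x; simp only [mem_inter_iff, mem_Iio, mem_Ioo]
        exact ⟨fun h => ⟨h.2.1, h.1⟩, fun h => ⟨h.2, h.1, h.2.trans hs.2⟩⟩]
    exact lintegral_const_mul'' _ (hg.mono_measure (Measure.restrict_mono
      (Ioo_subset_Ioo_right hs.2.le) le_rfl))
  rw [setLIntegral_congr_fun measurableSet_Ioo e1, setLIntegral_congr_fun measurableSet_Ioo e2]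
    at key
  exact key

theorem meanFlux_pos {p a : ℝ} {k f : ℝ → ℝ}
    (hkpos : ∀ x ∈ Ioo 0 a, 0 < k x) (hfpos : ∀ x ∈ Ioo 0 a, 0 < f x)
    (hg : IntervalIntegrable (fun t => k t * f t ^ (p - 1)) volume 0 a) {s : ℝ}
    (hs : s ∈ Ioo 0 a) : 0 < meanFlux p k f s := by
  refine div_pos ?_ (hkpos s hs)
  refine intervalIntegral.intervalIntegral_pos_of_pos_on (hg.mono_set ?_) (fun x hx => ?_) hs.1
  · rw [uIcc_of_le hs.1.le, uIcc_of_le (hs.1.trans hs.2).le]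
    exact Icc_subset_Icc_right hs.2.le
  · have hx' : x ∈ Ioo 0 a := ⟨hx.1, hx.2.trans hs.2⟩
    exact mul_pos (hkpos x hx') (Real.rpow_pos_of_pos (hfpos x hx') _)

/-- A positive supersolution of the mixed problem gives a weighted Poincaré inequality. -/
theorem halfPoincare_of_supersolution {p a μ : ℝ} {k f : ℝ → ℝ} (hp : 1 < p) (ha : 0 < a)
    (hμ : 0 ≤ μ) (hkpos : ∀ x ∈ Ioo 0 a, 0 < k x)
    (hki : IntervalIntegrable k volume 0 a) (hfc : ContinuousOn f (Icc 0 a))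
    (hfpos : ∀ x ∈ Ioo 0 a, 0 < f x)
    (hρ : IntervalIntegrable (fun s => meanFlux p k f s ^ (1 / (p - 1))) volume 0 a)
    (hsup : ∀ x ∈ Ioo 0 a,
      μ * (∫ s in x..a, meanFlux p k f s ^ (1 / (p - 1))) ^ (p - 1) ≤ f x ^ (p - 1)) :
    HalfPoincare p a μ k := by
  rintro u ⟨C, hu⟩ hua
  have hp0 : 0 < p := by linarith
  have hp1 : 0 < p - 1 := by linarith
  have hg : IntervalIntegrable (fun t => k t * f t ^ (p - 1)) volume 0 a := by
    refine hki.mul_continuousOn ?_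
    rw [uIcc_of_le ha.le]
    exact hfc.rpow_const fun _ _ => Or.inr hp1.le
  have hgpos : ∀ x ∈ Ioo 0 a, 0 < k x * f x ^ (p - 1) := fun x hx =>
    mul_pos (hkpos x hx) (Real.rpow_pos_of_pos (hfpos x hx) _)
  have hmf : ∀ s ∈ Ioo 0 a, 0 < meanFlux p k f s := fun s hs => meanFlux_pos hkpos hfpos hg hs
  have hgi : IntegrableOn (fun t => k t * f t ^ (p - 1)) (Ioo 0 a) :=
    ((intervalIntegrable_iff_integrableOn_Ioo_of_le ha.le).1 hg)
  have hρi : IntegrableOn (fun s => meanFlux p k f s ^ (1 / (p - 1))) (Ioo 0 a) :=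
    ((intervalIntegrable_iff_integrableOn_Ioo_of_le ha.le).1 hρ)
  have hρm : AEMeasurable (fun s => (meanFlux p k f s ^ (1 / (p - 1))) ^ (-(p - 1)))
      (volume.restrict (Ioo 0 a)) := hρi.aestronglyMeasurable.aemeasurable.pow_const _
  have hWm : AEMeasurable (fun s => ENNReal.ofReal
      (|deriv u s| ^ p * (meanFlux p k f s ^ (1 / (p - 1))) ^ (-(p - 1))))
      (volume.restrict (Ioo 0 a)) :=
    ((((measurable_deriv u).norm).pow_const p).aemeasurable.mul hρm).ennreal_ofReal
  -- Hölder with weight `θ = meanFlux^{1/(p-1)}` and the supersolution bound give `μ k |u|^p ≤ k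
  -- f^{p-1} ∫_x^a |u'|^p / meanFlux`. After the swap, the inner integral `∫_0^s k f^{p-1}` is
  -- `meanFlux(s) k(s)` by definition, and the flux cancels.
  have hstep : ∫⁻ x in Ioo 0 a, ENNReal.ofReal (μ * (|u x| ^ p * k x)) ≤
      ∫⁻ x in Ioo 0 a, ENNReal.ofReal (|deriv u x| ^ p * k x) := by
    calc ∫⁻ x in Ioo 0 a, ENNReal.ofReal (μ * (|u x| ^ p * k x))
        ≤ ∫⁻ x in Ioo 0 a, ENNReal.ofReal (k x * f x ^ (p - 1)) *
          ∫⁻ s in Ioo x a, ENNReal.ofReal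
            (|deriv u s| ^ p * (meanFlux p k f s ^ (1 / (p - 1))) ^ (-(p - 1))) := by
          refine setLIntegral_mono' measurableSet_Ioo fun x hx => ?_
          have hk := hkpos x hx
          have h1 := enorm_rpow_le_of_lipschitz hp hx.2.le hu hua
            (hρi.mono_set (Ioo_subset_Ioo_left hx.1.le))
            (fun s hs => Real.rpow_pos_of_pos (hmf s ⟨hx.1.trans hs.1, hs.2⟩) _)
          have h2 : ENNReal.ofReal (μ * k x) * ENNReal.ofReal
              ((∫ s in x..a, meanFlux p k f s ^ (1 / (p - 1))) ^ (p - 1)) ≤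
              ENNReal.ofReal (k x * f x ^ (p - 1)) := by
            rw [← ENNReal.ofReal_mul (by positivity)]
            refine ENNReal.ofReal_le_ofReal ?_
            have := mul_le_mul_of_nonneg_left (hsup x hx) hk.le
            linarith
          calc ENNReal.ofReal (μ * (|u x| ^ p * k x))
              = ENNReal.ofReal (μ * k x) * ENNReal.ofReal (|u x| ^ p) := by
                rw [← ENNReal.ofReal_mul (by positivity)]; ring_nf
            _ ≤ _ := mul_le_mul_right h1 _
            _ = _ := by rw [mul_left_comm, mul_comm]
            _ ≤ _ := mul_le_mul_left h2 _
      _ = ∫⁻ s in Ioo 0 a, ENNReal.ofReal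
            (|deriv u s| ^ p * (meanFlux p k f s ^ (1 / (p - 1))) ^ (-(p - 1))) *
          ∫⁻ x in Ioo 0 s, ENNReal.ofReal (k x * f x ^ (p - 1)) :=
        lintegral_triangle_swap hgi.aestronglyMeasurable.aemeasurable.ennreal_ofReal hWm
      _ = ∫⁻ x in Ioo 0 a, ENNReal.ofReal (|deriv u x| ^ p * k x) := by
          refine setLIntegral_congr_fun measurableSet_Ioo fun s hs => ?_
          have hfl := hmf s hs
          have hk := hkpos s hs
          have e1 : ∫⁻ x in Ioo 0 s, ENNReal.ofReal (k x * f x ^ (p - 1)) =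
              ENNReal.ofReal (meanFlux p k f s * k s) := by
            rw [meanFlux, div_mul_cancel₀ _ hk.ne', intervalIntegral.integral_of_le hs.1.le,
              integral_Ioc_eq_integral_Ioo, ofReal_integral_eq_lintegral_ofReal
                (hgi.mono_set (Ioo_subset_Ioo_right hs.2.le))]
            exact (ae_restrict_iff' measurableSet_Ioo).2 (Filter.Eventually.of_forall
              fun x hx => (hgpos x ⟨hx.1, hx.2.trans hs.2⟩).le)
          rw [e1, ← ENNReal.ofReal_mul (by positivity), ← Real.rpow_mul hfl.le,
            show 1 / (p - 1) * -(p - 1) = -1 by field_simp, Real.rpow_neg_one]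
          congr 1
          field_simp
  have hI1 : IntervalIntegrable (fun x => |u x| ^ p * k x) volume 0 a :=
    intervalIntegrable_rpow_mul hp0.le hu.continuous hki
  have hI2 : IntervalIntegrable (fun x => |deriv u x| ^ p * k x) volume 0 a :=
    intervalIntegrable_deriv_rpow_mul hp0.le hu hki
  have hn1 : ∀ᵐ x ∂volume.restrict (Ioo 0 a), 0 ≤ μ * (|u x| ^ p * k x) :=
    (ae_restrict_iff' measurableSet_Ioo).2 (Filter.Eventually.of_forall fun x hx => by
      have := hkpos x hx
      positivity)
  have hn2 : ∀ᵐ x ∂volume.restrict (Ioo 0 a), 0 ≤ |deriv u x| ^ p * k x :=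
    (ae_restrict_iff' measurableSet_Ioo).2 (Filter.Eventually.of_forall fun x hx => by
      have := hkpos x hx
      positivity)
  rw [← intervalIntegral.integral_const_mul, intervalIntegral.integral_of_le ha.le,
    intervalIntegral.integral_of_le ha.le, integral_Ioc_eq_integral_Ioo,
    integral_Ioc_eq_integral_Ioo]
  rw [← ofReal_integral_eq_lintegral_ofReal
    ((intervalIntegrable_iff_integrableOn_Ioo_of_le ha.le).1 (hI1.const_mul μ)) hn1,
    ← ofReal_integral_eq_lintegral_ofReal
    ((intervalIntegrable_iff_integrableOn_Ioo_of_le ha.le).1 hI2) hn2] at hstep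
  exact (ENNReal.ofReal_le_ofReal_iff (integral_nonneg_of_ae hn2)).1 hstep

/-! ### Comparison with the model on half intervals -/

/-- A positive continuous weight on `(0, D)` whose logarithmic derivative lies between those of
`s_κ(D - x)^{N-1}` and `s_κ(x)^{N-1}`. -/
structure IsMCPWeight (K N D : ℝ) (k : ℝ → ℝ) : Prop where
  pos : ∀ x ∈ Ioo 0 D, 0 < k x
  cont : ContinuousOn k (Ioo 0 D)
  integrable : IntervalIntegrable k volume 0 D
  mono : ∀ x y, 0 < x → x ≤ y → y < D → k x * leftModel K N D y ≤ k y * leftModel K N D x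
  anti : ∀ x y, 0 < x → x ≤ y → y < D →
    k y * sK (K / (N - 1)) x ^ (N - 1) ≤ k x * sK (K / (N - 1)) y ^ (N - 1)

/-- A mixed eigenfunction of the model on `[0, D / 2]`, in integral form. -/
structure IsModelEigenfunction (p K N D lam : ℝ) (f : ℝ → ℝ) : Prop where
  cont : ContinuousOn f (Icc 0 (D / 2))
  pos : ∀ x ∈ Ico 0 (D / 2), 0 < f x
  eq : ∀ x ∈ Icc 0 (D / 2), f x =
    ∫ s in x..(D / 2), (lam * meanFlux p (leftModel K N D) f s) ^ (1 / (p - 1))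

theorem IsModelEigenfunction.nonneg {p K N D lam : ℝ} {f : ℝ → ℝ}
    (hf : IsModelEigenfunction p K N D lam f) {x : ℝ} (hx : x ∈ Icc 0 (D / 2)) : 0 ≤ f x := by
  rcases hx.2.eq_or_lt with h | h
  · rw [hf.eq x hx, h, intervalIntegral.integral_same]
  · exact (hf.pos x ⟨hx.1, h⟩).le

theorem IsMCPWeight.intervalIntegrable {K N D a b : ℝ} {k : ℝ → ℝ} (hk : IsMCPWeight K N D k)
    (ha : 0 ≤ a) (hab : a ≤ b) (hb : b ≤ D) : IntervalIntegrable k volume a b := by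
  refine hk.integrable.mono_set ?_
  rw [uIcc_of_le hab, uIcc_of_le (ha.trans (hab.trans hb))]
  exact Icc_subset_Icc ha hb

theorem intervalIntegrable_mul_rpow {p a b : ℝ} {k f : ℝ → ℝ} (hp : 1 < p) (hab : a ≤ b)
    (hk : IntervalIntegrable k volume a b) (hf : ContinuousOn f (Icc a b)) :
    IntervalIntegrable (fun t => k t * f t ^ (p - 1)) volume a b := by
  refine hk.mul_continuousOn ?_
  rw [uIcc_of_le hab]
  exact hf.rpow_const fun _ _ => Or.inr (by linarith)

theorem continuousOn_meanFlux_model {p K N D lam : ℝ} {f : ℝ → ℝ} (hp : 1 < p) (hK : K ≤ 0)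
    (hN : 1 < N) (hD : 0 < D) (hf : IsModelEigenfunction p K N D lam f) :
    ContinuousOn (meanFlux p (leftModel K N D) f) (Icc 0 (D / 2)) := by
  have hm := continuous_leftModel (K := K) (D := D) hN
  have hint := intervalIntegrable_mul_rpow hp (by linarith : 0 ≤ D / 2)
    (hm.intervalIntegrable 0 (D / 2)) hf.cont
  have := intervalIntegral.continuousOn_primitive_interval' hint left_mem_uIcc
  rw [uIcc_of_le (by linarith : 0 ≤ D / 2)] at this
  exact this.div hm.continuousOn fun x hx => (leftModel_pos hK hN (by linarith [hx.2])).ne'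

theorem continuousOn_meanFlux {p K N D lam : ℝ} {k f : ℝ → ℝ} (hp : 1 < p)
    (hD : 0 < D) (hf : IsModelEigenfunction p K N D lam f) (hk : IsMCPWeight K N D k) :
    ContinuousOn (meanFlux p k f) (Ioc 0 (D / 2)) := by
  have hint := intervalIntegrable_mul_rpow hp (by linarith : 0 ≤ D / 2)
    (hk.intervalIntegrable le_rfl (by linarith) (by linarith)) hf.cont
  have := intervalIntegral.continuousOn_primitive_interval' hint left_mem_uIcc
  rw [uIcc_of_le (by linarith : 0 ≤ D / 2)] at this
  have hsub : Ioc 0 (D / 2) ⊆ Ioo 0 D := fun x hx => ⟨hx.1, by linarith [hx.2]⟩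
  exact (this.mono Ioc_subset_Icc_self).div (hk.cont.mono hsub)
    fun x hx => (hk.pos x (hsub hx)).ne'

/-- Monotonicity of the averaged flux in the weight, with a quantitative gain. -/
theorem meanFlux_le_of_gain {p K N D lam d τ s : ℝ} {k f : ℝ → ℝ} (hp : 1 < p) (hK : K ≤ 0)
    (hN : 1 < N) (hf : IsModelEigenfunction p K N D lam f)
    (hk : IsMCPWeight K N D k) (hτ : 0 < τ) (hτs : τ ≤ s) (hs : s ≤ D / 2)
    (hd : k τ / leftModel K N D τ ≤ (1 - d) * (k s / leftModel K N D s)) :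
    meanFlux p k f s ≤ ((∫ t in (0 : ℝ)..s, leftModel K N D t * f t ^ (p - 1)) -
      d * ∫ t in (0 : ℝ)..τ, leftModel K N D t * f t ^ (p - 1)) / leftModel K N D s := by
  have hs0 : 0 < s := hτ.trans_le hτs
  have hD : 0 < D := by linarith
  have hks : 0 < k s := hk.pos s ⟨hs0, by linarith⟩
  have hm := continuous_leftModel (K := K) (D := D) hN
  have hmpos : ∀ x, x ≤ D / 2 → 0 < leftModel K N D x := fun x hx =>
    leftModel_pos hK hN (by linarith)
  have hfp : ∀ x ∈ Icc 0 (D / 2), 0 ≤ f x ^ (p - 1) := fun x hx => Real.rpow_nonneg (hf.nonneg hx) _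
  have hmi : ∀ a b, 0 ≤ a → a ≤ b → b ≤ D / 2 →
      IntervalIntegrable (fun t => leftModel K N D t * f t ^ (p - 1)) volume a b :=
    fun a b ha hab hb => intervalIntegrable_mul_rpow hp hab (hm.intervalIntegrable a b)
      (hf.cont.mono (Icc_subset_Icc ha hb))
  have hki : ∀ a b, 0 ≤ a → a ≤ b → b ≤ D / 2 →
      IntervalIntegrable (fun t => k t * f t ^ (p - 1)) volume a b :=
    fun a b ha hab hb => intervalIntegrable_mul_rpow hp hab
      (hk.intervalIntegrable ha hab (by linarith)) (hf.cont.mono (Icc_subset_Icc ha hb))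
  -- Since `g = k / m` is nondecreasing, `k ≤ g(b) m` to the left of `b`. It is used with `b = τ` on
  -- `[0, τ]`, where `g(τ) ≤ (1 - d) g(s)` produces the gain, and with `b = s` on `[τ, s]`.
  have hcmp : ∀ a b, 0 ≤ a → a ≤ b → 0 < b → b ≤ D / 2 → ∫ t in a..b, k t * f t ^ (p - 1) ≤
      k b / leftModel K N D b * ∫ t in a..b, leftModel K N D t * f t ^ (p - 1) := by
    intro a b ha hab hb0 hb
    rw [← intervalIntegral.integral_const_mul]
    refine intervalIntegral.integral_mono_on_of_le_Ioo hab (hki a b ha hab hb)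
      ((hmi a b ha hab hb).const_mul _) fun t ht => ?_
    rw [← mul_assoc]
    refine mul_le_mul_of_nonneg_right ?_ (hfp t ⟨ha.trans ht.1.le, ht.2.le.trans hb⟩)
    rw [div_mul_eq_mul_div, le_div_iff₀ (hmpos b hb)]
    exact hk.mono t b (ha.trans_lt ht.1) ht.2.le (by linarith)
  have h1 := hcmp 0 τ le_rfl hτ.le hτ (hτs.trans hs)
  have h2 := hcmp τ s hτ.le hτs hs0 hs
  have e1 := intervalIntegral.integral_add_adjacent_intervals
    (hki 0 τ le_rfl hτ.le (hτs.trans hs)) (hki τ s hτ.le hτs hs)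
  have e2 := intervalIntegral.integral_add_adjacent_intervals
    (hmi 0 τ le_rfl hτ.le (hτs.trans hs)) (hmi τ s hτ.le hτs hs)
  have hI0 : 0 ≤ ∫ t in (0 : ℝ)..τ, leftModel K N D t * f t ^ (p - 1) :=
    intervalIntegral.integral_nonneg hτ.le fun t ht => mul_nonneg
      (hmpos t (by linarith [ht.2])).le (hfp t ⟨ht.1, by linarith [ht.2]⟩)
  have h3 := mul_le_mul_of_nonneg_right hd hI0
  unfold meanFlux
  rw [div_le_div_iff₀ hks (hmpos s hs), ← e1, ← e2]
  set g := k s / leftModel K N D s with hg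
  have hgm : g * leftModel K N D s = k s := div_mul_cancel₀ _ (hmpos s hs).ne'
  rw [← hgm]
  have hms := hmpos s hs
  have : (∫ t in (0 : ℝ)..τ, k t * f t ^ (p - 1)) + (∫ t in τ..s, k t * f t ^ (p - 1)) ≤
      g * ((∫ t in (0 : ℝ)..τ, leftModel K N D t * f t ^ (p - 1)) +
        (∫ t in τ..s, leftModel K N D t * f t ^ (p - 1)) -
      d * ∫ t in (0 : ℝ)..τ, leftModel K N D t * f t ^ (p - 1)) := by linarith
  calc _ ≤ _ := mul_le_mul_of_nonneg_right this hms.le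
    _ = _ := by ring

theorem meanFlux_le {p K N D lam s : ℝ} {k f : ℝ → ℝ} (hp : 1 < p) (hK : K ≤ 0)
    (hN : 1 < N) (hf : IsModelEigenfunction p K N D lam f)
    (hk : IsMCPWeight K N D k) (hs0 : 0 < s) (hs : s ≤ D / 2) :
    meanFlux p k f s ≤ meanFlux p (leftModel K N D) f s := by
  have := meanFlux_le_of_gain (d := 0) hp hK hN hf hk hs0 le_rfl hs (by simp)
  simpa [meanFlux] using this

theorem meanFlux_nonneg {p K N D lam s : ℝ} {k f : ℝ → ℝ}
    (hf : IsModelEigenfunction p K N D lam f)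
    (hkpos : ∀ x ∈ Ioo 0 D, 0 < k x) (hs0 : 0 < s) (hs : s ≤ D / 2) : 0 ≤ meanFlux p k f s := by
  refine div_nonneg ?_ (hkpos s ⟨hs0, by linarith⟩).le
  rw [intervalIntegral.integral_of_le hs0.le, integral_Ioc_eq_integral_Ioo]
  exact setIntegral_nonneg measurableSet_Ioo fun t ht =>
    mul_nonneg (hkpos t ⟨ht.1, by linarith [ht.2]⟩).le
      (Real.rpow_nonneg (hf.nonneg ⟨ht.1.le, by linarith [ht.2]⟩) _)

theorem meanFlux_rpow_le {p K N D lam s : ℝ} {k f : ℝ → ℝ} (hp : 1 < p) (hK : K ≤ 0)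
    (hN : 1 < N) (hf : IsModelEigenfunction p K N D lam f)
    (hk : IsMCPWeight K N D k) (hs0 : 0 < s) (hs : s ≤ D / 2) :
    meanFlux p k f s ^ (1 / (p - 1)) ≤ meanFlux p (leftModel K N D) f s ^ (1 / (p - 1)) :=
  Real.rpow_le_rpow (meanFlux_nonneg hf hk.pos hs0 hs) (meanFlux_le hp hK hN hf hk hs0 hs)
    (by have : 0 < p - 1 := by linarith
        positivity)

theorem continuousOn_meanFlux_model_rpow {p K N D lam : ℝ} {f : ℝ → ℝ} (hp : 1 < p) (hK : K ≤ 0)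
    (hN : 1 < N) (hD : 0 < D) (hf : IsModelEigenfunction p K N D lam f) :
    ContinuousOn (fun s => meanFlux p (leftModel K N D) f s ^ (1 / (p - 1))) (Icc 0 (D / 2)) :=
  (continuousOn_meanFlux_model hp hK hN hD hf).rpow_const fun _ _ => Or.inr (by
    have : 0 < p - 1 := by linarith
    positivity)

theorem intervalIntegrable_meanFlux_model {p K N D lam : ℝ} {f : ℝ → ℝ} (hp : 1 < p) (hK : K ≤ 0)
    (hN : 1 < N) (hD : 0 < D) (hf : IsModelEigenfunction p K N D lam f) {a b : ℝ} (ha : 0 ≤ a)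
    (hab : a ≤ b) (hb : b ≤ D / 2) :
    IntervalIntegrable (fun s => meanFlux p (leftModel K N D) f s ^ (1 / (p - 1))) volume a b :=
  ((continuousOn_meanFlux_model_rpow hp hK hN hD hf).mono
    (Icc_subset_Icc ha hb)).intervalIntegrable_of_Icc hab

/-- Nothing is known about `k` at `0` itself, so integrability comes from domination by the model
flux, which is continuous up to `0`. -/
theorem intervalIntegrable_meanFlux {p K N D lam : ℝ} {k f : ℝ → ℝ} (hp : 1 < p) (hK : K ≤ 0)
    (hN : 1 < N) (hD : 0 < D) (hf : IsModelEigenfunction p K N D lam f)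
    (hk : IsMCPWeight K N D k) {a b : ℝ} (ha : 0 ≤ a)
    (hab : a ≤ b) (hb : b ≤ D / 2) :
    IntervalIntegrable (fun s => meanFlux p k f s ^ (1 / (p - 1))) volume a b := by
  have hp1 : 0 < p - 1 := by linarith
  have hsub : Ioc a b ⊆ Ioc 0 (D / 2) := Ioc_subset_Ioc ha hb
  refine (intervalIntegrable_meanFlux_model hp hK hN hD hf ha hab hb).mono_fun ?_ ?_
  · rw [uIoc_of_le hab]
    exact (((continuousOn_meanFlux hp hD hf hk).mono hsub).rpow_const
      fun _ _ => Or.inr (by positivity)).aestronglyMeasurable measurableSet_Ioc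
  · refine (ae_restrict_iff' measurableSet_uIoc).2 (Filter.Eventually.of_forall fun s hs => ?_)
    rw [uIoc_of_le hab] at hs
    have hs' := hsub hs
    beta_reduce
    rw [Real.norm_of_nonneg (Real.rpow_nonneg (meanFlux_nonneg hf hk.pos hs'.1 hs'.2) _)]
    exact (meanFlux_rpow_le hp hK hN hf hk hs'.1 hs'.2).trans (le_abs_self _)

theorem IsModelEigenfunction.eq_mul {p K N D lam : ℝ} {f : ℝ → ℝ} (hK : K ≤ 0)
    (hN : 1 < N) (hlam : 0 < lam)
    (hf : IsModelEigenfunction p K N D lam f) {x : ℝ} (hx : x ∈ Icc 0 (D / 2)) :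
    f x = lam ^ (1 / (p - 1)) *
      ∫ s in x..(D / 2), meanFlux p (leftModel K N D) f s ^ (1 / (p - 1)) := by
  rw [hf.eq x hx, ← intervalIntegral.integral_const_mul,
    intervalIntegral.integral_of_le hx.2, intervalIntegral.integral_of_le hx.2]
  refine setIntegral_congr_fun measurableSet_Ioc fun s hs => ?_
  have hs0 : 0 < s := hx.1.trans_lt hs.1
  exact Real.mul_rpow hlam.le (meanFlux_nonneg hf
    (fun x hx => leftModel_pos hK hN hx.2) hs0 hs.2)

theorem halfPoincare_of_ratio {p K N D lam a ε : ℝ} {k f : ℝ → ℝ} (hp : 1 < p) (hK : K ≤ 0)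
    (hN : 1 < N) (hD : 0 < D) (hlam : 0 < lam) (hf : IsModelEigenfunction p K N D lam f)
    (hk : IsMCPWeight K N D k) (ha : 0 < a) (haD : a ≤ D / 2) (hε : 0 < ε) (hε1 : ε < 1)
    (h : ∀ x ∈ Ioo 0 a, ∫ s in x..a, meanFlux p k f s ^ (1 / (p - 1)) ≤
      (1 - ε) * ∫ s in x..(D / 2), meanFlux p (leftModel K N D) f s ^ (1 / (p - 1))) :
    ∃ μ, lam < μ ∧ HalfPoincare p a μ k := by
  have hp1 : 0 < p - 1 := by linarith
  have hpow : 0 < (1 - ε) ^ (p - 1) := Real.rpow_pos_of_pos (by linarith) _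
  have hpow1 : (1 - ε) ^ (p - 1) < 1 := Real.rpow_lt_one (by linarith) (by linarith) hp1
  -- Since `f = λ^{1/(p-1)} ∫_x^{D/2} meanFlux^{1/(p-1)}` for the model, a factor `1 - ε` in the
  -- integral becomes `(1 - ε)^{p-1}` in the eigenvalue.
  refine ⟨lam / (1 - ε) ^ (p - 1), ?_, ?_⟩
  · rw [lt_div_iff₀ hpow]; nlinarith
  · refine halfPoincare_of_supersolution (f := f) hp ha (by positivity)
      (fun x hx => hk.pos x ⟨hx.1, by linarith [hx.2]⟩)
      (hk.intervalIntegrable le_rfl ha.le (by linarith))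
      (hf.cont.mono (Icc_subset_Icc_right haD)) (fun x hx => hf.pos x ⟨hx.1.le, by linarith [hx.2]⟩)
      (intervalIntegrable_meanFlux hp hK hN hD hf hk le_rfl ha.le haD) fun x hx => ?_
    have hxm : x ∈ Icc 0 (D / 2) := ⟨hx.1.le, by linarith [hx.2]⟩
    have hv0 : 0 ≤ ∫ s in x..a, meanFlux p k f s ^ (1 / (p - 1)) := by
      refine intervalIntegral.integral_nonneg hx.2.le fun s hs => ?_
      exact Real.rpow_nonneg (meanFlux_nonneg hf hk.pos (hx.1.trans_le hs.1)
        (hs.2.trans haD)) _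
    have hA0 : 0 ≤ ∫ s in x..(D / 2), meanFlux p (leftModel K N D) f s ^ (1 / (p - 1)) := by
      refine intervalIntegral.integral_nonneg hxm.2 fun s hs => ?_
      exact Real.rpow_nonneg (meanFlux_nonneg hf
        (fun x hx => leftModel_pos hK hN hx.2) (hx.1.trans_le hs.1) hs.2) _
    have h1 := Real.rpow_le_rpow hv0 (h x hx) hp1.le
    rw [Real.mul_rpow (by linarith) hA0] at h1
    rw [hf.eq_mul hK hN hlam hxm, Real.mul_rpow (by positivity) hA0, ← Real.rpow_mul hlam.le,
      one_div_mul_cancel hp1.ne', Real.rpow_one, div_mul_eq_mul_div, div_le_iff₀ hpow]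
    calc _ ≤ _ := mul_le_mul_of_nonneg_left h1 hlam.le
      _ = _ := by ring

theorem integral_meanFlux_model_pos {p K N D lam x : ℝ} {f : ℝ → ℝ} (hK : K ≤ 0)
    (hN : 1 < N) (hlam : 0 < lam) (hf : IsModelEigenfunction p K N D lam f)
    (hx : x ∈ Ico 0 (D / 2)) :
    0 < ∫ s in x..(D / 2), meanFlux p (leftModel K N D) f s ^ (1 / (p - 1)) := by
  have h := hf.pos x hx
  rw [hf.eq_mul hK hN hlam (Ico_subset_Icc_self hx)] at h
  exact pos_of_mul_pos_right h (by positivity)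

theorem integral_meanFlux_model_anti {p K N D lam x y : ℝ} {f : ℝ → ℝ} (hp : 1 < p) (hK : K ≤ 0)
    (hN : 1 < N) (hD : 0 < D) (hf : IsModelEigenfunction p K N D lam f)
    (hx : 0 ≤ x) (hxy : x ≤ y) (hy : y ≤ D / 2) :
    ∫ s in y..(D / 2), meanFlux p (leftModel K N D) f s ^ (1 / (p - 1)) ≤
      ∫ s in x..(D / 2), meanFlux p (leftModel K N D) f s ^ (1 / (p - 1)) := by
  have e := intervalIntegral.integral_add_adjacent_intervals
    (intervalIntegrable_meanFlux_model hp hK hN hD hf hx hxy hy)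
    (intervalIntegrable_meanFlux_model hp hK hN hD hf (hx.trans hxy) hy le_rfl)
  have : 0 ≤ ∫ s in x..y, meanFlux p (leftModel K N D) f s ^ (1 / (p - 1)) := by
    rw [intervalIntegral.integral_of_le hxy]
    exact setIntegral_nonneg measurableSet_Ioc fun s hs => Real.rpow_nonneg (meanFlux_nonneg hf
        (fun x hx => leftModel_pos hK hN hx.2) (hx.trans_lt hs.1) (hs.2.trans hy)) _
  linarith

/-- On an interval shorter than `D / 2` the constant is strictly better than the model one. -/
theorem exists_halfPoincare_of_lt {p K N D lam a : ℝ} {k f : ℝ → ℝ} (hp : 1 < p) (hK : K ≤ 0)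
    (hN : 1 < N) (hD : 0 < D) (hlam : 0 < lam) (hf : IsModelEigenfunction p K N D lam f)
    (hk : IsMCPWeight K N D k) (ha : 0 < a) (haD : a < D / 2) :
    ∃ μ, lam < μ ∧ HalfPoincare p a μ k := by
  have hAa := integral_meanFlux_model_pos hK hN hlam hf ⟨ha.le, haD⟩
  have hA0 := integral_meanFlux_model_pos hK hN hlam hf ⟨le_rfl, ha.trans haD⟩
  have hAa0 := integral_meanFlux_model_anti hp hK hN hD hf le_rfl ha.le haD.le
  -- With `A(x)` the model integral from `x` to `D/2`, the gain is the missing piece `A(a)`: the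
  -- integral from `x` to `a` is at most `A(x) - A(a)`, and `A(x) ≤ A(0)`. The factor `2` only
  -- ensures `ε < 1`.
  refine halfPoincare_of_ratio (ε := (∫ s in a..(D / 2),
    meanFlux p (leftModel K N D) f s ^ (1 / (p - 1))) / (2 * ∫ s in (0 : ℝ)..(D / 2),
    meanFlux p (leftModel K N D) f s ^ (1 / (p - 1)))) hp hK hN hD hlam hf hk ha haD.le
    (by positivity) ((div_lt_one (by positivity)).2 (by linarith)) fun x hx => ?_
  have hAx0 := integral_meanFlux_model_anti hp hK hN hD hf le_rfl hx.1.le (hx.2.trans haD).le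
  have hmodel := intervalIntegrable_meanFlux_model hp hK hN hD hf hx.1.le hx.2.le haD.le
  have e := intervalIntegral.integral_add_adjacent_intervals hmodel
    (intervalIntegrable_meanFlux_model hp hK hN hD hf ha.le haD.le le_rfl)
  have h1 : ∫ s in x..a, meanFlux p k f s ^ (1 / (p - 1)) ≤
      ∫ s in x..a, meanFlux p (leftModel K N D) f s ^ (1 / (p - 1)) :=
    intervalIntegral.integral_mono_on hx.2.le
      (intervalIntegrable_meanFlux hp hK hN hD hf hk hx.1.le hx.2.le haD.le) hmodel
      fun s hs => meanFlux_rpow_le hp hK hN hf hk (hx.1.trans_le hs.1) (hs.2.trans haD.le)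
  set Aa := ∫ s in a..(D / 2), meanFlux p (leftModel K N D) f s ^ (1 / (p - 1))
  set A0 := ∫ s in (0 : ℝ)..(D / 2), meanFlux p (leftModel K N D) f s ^ (1 / (p - 1))
  set Ax := ∫ s in x..(D / 2), meanFlux p (leftModel K N D) f s ^ (1 / (p - 1))
  have h2 : Aa / (2 * A0) * Ax ≤ Aa := by
    rw [div_mul_eq_mul_div, div_le_iff₀ (by positivity)]
    nlinarith
  linarith

/-- On `[0, D / 2]` the constant is strictly better than the model one unless the weight is a
multiple of the model. -/
theorem exists_halfPoincare_of_gain {p K N D lam τ τ' : ℝ} {k f : ℝ → ℝ} (hp : 1 < p)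
    (hK : K ≤ 0) (hN : 1 < N) (hD : 0 < D) (hlam : 0 < lam)
    (hf : IsModelEigenfunction p K N D lam f) (hk : IsMCPWeight K N D k)
    (hτ : 0 < τ) (hττ' : τ < τ') (hτ' : τ' < D / 2)
    (hlt : k τ / leftModel K N D τ < k τ' / leftModel K N D τ') :
    ∃ μ, lam < μ ∧ HalfPoincare p (D / 2) μ k := by
  have hp1 : 0 < p - 1 := by linarith
  have hL : 0 < D / 2 := by linarith
  have hmpos : ∀ x, x ≤ D / 2 → 0 < leftModel K N D x := fun x hx =>
    leftModel_pos hK hN (by linarith)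
  have hg0 : 0 < k τ / leftModel K N D τ :=
    div_pos (hk.pos τ ⟨hτ, by linarith⟩) (hmpos τ (by linarith))
  have hg1 : 0 < k τ' / leftModel K N D τ' := hg0.trans hlt
  -- Chosen so that `g(τ) = (1 - d) g(τ')` for `g = k / m`; by monotonicity `g(τ) ≤ (1 - d) g(s)`
  -- for every `s ≥ τ'`.
  obtain ⟨d, hd⟩ : ∃ d, d = 1 - (k τ / leftModel K N D τ) / (k τ' / leftModel K N D τ') := ⟨_, rfl⟩
  have hd0 : 0 < d := by
    rw [hd]; linarith [(div_lt_one hg1).2 hlt]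
  have hd1 : d < 1 := by rw [hd]; linarith [div_pos hg0 hg1]
  have hmi : ∀ a b, 0 ≤ a → a ≤ b → b ≤ D / 2 →
      IntervalIntegrable (fun t => leftModel K N D t * f t ^ (p - 1)) volume a b :=
    fun a b ha hab hb => intervalIntegrable_mul_rpow hp hab
      ((continuous_leftModel hN).intervalIntegrable a b) (hf.cont.mono (Icc_subset_Icc ha hb))
  obtain ⟨I, hI⟩ : ∃ I : ℝ → ℝ, I = fun s =>
    ∫ t in (0 : ℝ)..s, leftModel K N D t * f t ^ (p - 1) := ⟨_, rfl⟩
  have hImono : ∀ x y, 0 ≤ x → x ≤ y → y ≤ D / 2 → I x ≤ I y := by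
    intro x y hx hxy hy
    have e := intervalIntegral.integral_add_adjacent_intervals (hmi 0 x le_rfl hx (hxy.trans hy))
      (hmi x y hx hxy hy)
    have : 0 ≤ ∫ t in x..y, leftModel K N D t * f t ^ (p - 1) :=
      intervalIntegral.integral_nonneg hxy fun t ht => mul_nonneg (hmpos t (ht.2.trans hy)).le
        (Real.rpow_nonneg (hf.nonneg ⟨hx.trans ht.1, ht.2.trans hy⟩) _)
    rw [hI]
    simp only
    linarith
  have hIτ : 0 < I τ := by
    rw [hI]
    refine intervalIntegral.intervalIntegral_pos_of_pos_on (hmi 0 τ le_rfl hτ.le (by linarith))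
      (fun t ht => ?_) hτ
    exact mul_pos (hmpos t (by linarith [ht.2]))
      (Real.rpow_pos_of_pos (hf.pos t ⟨ht.1.le, by linarith [ht.2]⟩) _)
  have hIτL : I τ ≤ I (D / 2) := hImono τ (D / 2) hτ.le (by linarith) le_rfl
  have hIL : 0 < I (D / 2) := hIτ.trans_le hIτL
  -- Dividing by the largest value `I(D/2)` makes the relative gain uniform in `s ∈ [τ', D/2]`.
  obtain ⟨δ, hδ⟩ : ∃ δ, δ = d * I τ / I (D / 2) := ⟨_, rfl⟩
  have hδ0 : 0 < δ := by rw [hδ]; positivity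
  have hδ1 : δ < 1 := by
    rw [hδ, div_lt_one hIL]; nlinarith
  have hflux : ∀ s ∈ Icc τ' (D / 2),
      meanFlux p k f s ≤ (1 - δ) * meanFlux p (leftModel K N D) f s := by
    intro s hs
    have hs0 : 0 < s := by linarith [hs.1]
    have hgs : k τ' / leftModel K N D τ' ≤ k s / leftModel K N D s := by
      rw [div_le_div_iff₀ (hmpos τ' hτ'.le) (hmpos s hs.2)]
      exact hk.mono τ' s (by linarith) hs.1 (by linarith [hs.2])
    refine (meanFlux_le_of_gain hp hK hN hf hk hτ (by linarith [hs.1]) hs.2 (d := d) ?_).trans ?_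
    · have : k τ / leftModel K N D τ = (1 - d) * (k τ' / leftModel K N D τ') := by
        rw [hd, sub_sub_cancel, div_mul_cancel₀ _ hg1.ne']
      rw [this]
      exact mul_le_mul_of_nonneg_left hgs (by linarith)
    · have h1 : δ * I s ≤ d * I τ := by
        rw [hδ, div_mul_eq_mul_div, div_le_iff₀ hIL]
        exact mul_le_mul_of_nonneg_left (hImono s (D / 2) hs0.le hs.2 le_rfl) (by positivity)
      rw [meanFlux, ← mul_div_assoc]
      refine div_le_div_of_nonneg_right ?_ (hmpos s hs.2).le
      rw [hI] at h1
      simp only at h1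
      linarith
  obtain ⟨η, hη⟩ : ∃ η, η = 1 - (1 - δ) ^ (1 / (p - 1)) := ⟨_, rfl⟩
  have hη0 : 0 < η := by
    rw [hη]; linarith [Real.rpow_lt_one (by linarith : 0 ≤ 1 - δ) (by linarith)
      (by positivity : 0 < 1 / (p - 1))]
  have hη1 : η < 1 := by
    rw [hη]; linarith [Real.rpow_pos_of_pos (by linarith : 0 < 1 - δ) (1 / (p - 1))]
  have hfluxpow : ∀ s ∈ Icc τ' (D / 2), meanFlux p k f s ^ (1 / (p - 1)) ≤
      (1 - η) * meanFlux p (leftModel K N D) f s ^ (1 / (p - 1)) := by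
    intro s hs
    have hs0 : 0 < s := by linarith [hs.1]
    have := Real.rpow_le_rpow (meanFlux_nonneg hf hk.pos hs0 hs.2) (hflux s hs)
      (by positivity : 0 ≤ 1 / (p - 1))
    rw [Real.mul_rpow (by linarith) (meanFlux_nonneg hf
      (fun x hx => leftModel_pos hK hN hx.2) hs0 hs.2)] at this
    rw [hη, sub_sub_cancel]
    exact this
  have hAτ := integral_meanFlux_model_pos hK hN hlam hf ⟨(hτ.trans hττ').le, hτ'⟩
  have hA0 := integral_meanFlux_model_pos hK hN hlam hf ⟨le_rfl, hL⟩
  have hAτ0 := integral_meanFlux_model_anti hp hK hN hD hf le_rfl (hτ.trans hττ').le hτ'.le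
  have htail : ∀ x ∈ Icc τ' (D / 2), ∫ s in x..(D / 2), meanFlux p k f s ^ (1 / (p - 1)) ≤
      (1 - η) * ∫ s in x..(D / 2), meanFlux p (leftModel K N D) f s ^ (1 / (p - 1)) := by
    intro x hx
    have hx0 : 0 ≤ x := by linarith [hx.1]
    rw [← intervalIntegral.integral_const_mul]
    exact intervalIntegral.integral_mono_on hx.2
      (intervalIntegrable_meanFlux hp hK hN hD hf hk hx0 hx.2 le_rfl)
      ((intervalIntegrable_meanFlux_model hp hK hN hD hf hx0 hx.2 le_rfl).const_mul _)
      fun s hs => hfluxpow s ⟨hx.1.trans hs.1, hs.2⟩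
  -- The flux gains a factor only on `[τ', D/2]`, yet every integral from `x < τ'` contains that
  -- whole piece, so it gains at least `η A(τ')`, a fixed fraction of `A(x) ≤ A(0)`.
  refine halfPoincare_of_ratio (ε := η * (∫ s in τ'..(D / 2),
    meanFlux p (leftModel K N D) f s ^ (1 / (p - 1))) / ∫ s in (0 : ℝ)..(D / 2),
    meanFlux p (leftModel K N D) f s ^ (1 / (p - 1))) hp hK hN hD hlam hf hk hL le_rfl
    (by positivity) ((div_lt_one (by positivity)).2 (by nlinarith)) fun x hx => ?_
  have hAx0 := integral_meanFlux_model_anti hp hK hN hD hf le_rfl hx.1.le hx.2.le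
  have hAx := integral_meanFlux_model_pos hK hN hlam hf ⟨hx.1.le, hx.2⟩
  set A0 := ∫ s in (0 : ℝ)..(D / 2), meanFlux p (leftModel K N D) f s ^ (1 / (p - 1)) with hA0def
  set Aτ := ∫ s in τ'..(D / 2), meanFlux p (leftModel K N D) f s ^ (1 / (p - 1)) with hAτdef
  rcases le_total τ' x with h | h
  · refine (htail x ⟨h, hx.2.le⟩).trans (mul_le_mul_of_nonneg_right ?_ hAx.le)
    have : η * Aτ / A0 ≤ η := by
      rw [div_le_iff₀ hA0]
      exact mul_le_mul_of_nonneg_left hAτ0 hη0.le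
    linarith
  · have hmodel := intervalIntegrable_meanFlux_model hp hK hN hD hf hx.1.le h hτ'.le
    have hki := intervalIntegrable_meanFlux hp hK hN hD hf hk hx.1.le h hτ'.le
    have e1 := intervalIntegral.integral_add_adjacent_intervals hmodel
      (intervalIntegrable_meanFlux_model hp hK hN hD hf (hτ.trans hττ').le hτ'.le le_rfl)
    have e2 := intervalIntegral.integral_add_adjacent_intervals hki
      (intervalIntegrable_meanFlux hp hK hN hD hf hk (hτ.trans hττ').le hτ'.le le_rfl)
    have h1 : ∫ s in x..τ', meanFlux p k f s ^ (1 / (p - 1)) ≤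
        ∫ s in x..τ', meanFlux p (leftModel K N D) f s ^ (1 / (p - 1)) :=
      intervalIntegral.integral_mono_on h hki hmodel
        fun s hs => meanFlux_rpow_le hp hK hN hf hk (hx.1.trans_le hs.1) (hs.2.trans hτ'.le)
    have h2 := htail τ' ⟨le_rfl, hτ'.le⟩
    rw [← hAτdef] at h2 e1
    set Ax := ∫ s in x..(D / 2), meanFlux p (leftModel K N D) f s ^ (1 / (p - 1))
    have h3 : η * Aτ / A0 * Ax ≤ η * Aτ := by
      rw [div_mul_eq_mul_div, div_le_iff₀ hA0]
      exact mul_le_mul_of_nonneg_left hAx0 (by positivity)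
    linarith

/-! ### Stability under dilation -/

theorem self_le_sK {κ x : ℝ} (hκ : κ ≤ 0) (hx : 0 ≤ x) : x ≤ sK κ x := by
  unfold sK
  split_ifs with h
  · exact le_rfl
  · have hr : 0 < Real.sqrt (-κ) := Real.sqrt_pos.2 (neg_pos.2 (lt_of_le_of_ne hκ h))
    rw [le_div_iff₀ hr, mul_comm]
    exact Real.self_le_sinh_iff.2 (by positivity)

theorem sK_sub_le {κ x y D : ℝ} (hκ : κ ≤ 0) (hx : 0 ≤ x) (hxy : x ≤ y) (hy : y ≤ D) :
    sK κ y - sK κ x ≤ Real.cosh (Real.sqrt (-κ) * D) * (y - x) := by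
  unfold sK
  split_ifs with h
  · nlinarith [Real.one_le_cosh (Real.sqrt (-κ) * D)]
  · have hr : 0 < Real.sqrt (-κ) := Real.sqrt_pos.2 (neg_pos.2 (lt_of_le_of_ne hκ h))
    set r := Real.sqrt (-κ)
    rcases hxy.eq_or_lt with rfl | hlt
    · simp
    obtain ⟨c, hc, hc'⟩ := exists_hasDerivAt_eq_slope (fun t => Real.sinh (r * t) / r)
      (fun t => Real.cosh (r * t)) hlt (by fun_prop) fun t _ => by
        refine (((Real.hasDerivAt_sinh (r * t)).comp t
          ((hasDerivAt_id t).const_mul r)).div_const r).congr_deriv ?_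
        field_simp
    rw [eq_div_iff (by linarith)] at hc'
    rw [← hc']
    refine mul_le_mul_of_nonneg_right ?_ (by linarith)
    have hc0 : 0 ≤ r * c := mul_nonneg hr.le (by linarith [hc.1])
    refine Real.cosh_le_cosh.2 ?_
    rw [abs_of_nonneg hc0, abs_of_nonneg (mul_nonneg hr.le (by linarith))]
    exact mul_le_mul_of_nonneg_left (by linarith [hc.2]) hr.le

/-- Comparison of an MCP weight with its dilation. -/
theorem IsMCPWeight.dilation {K N D x β : ℝ} {k : ℝ → ℝ} (hK : K ≤ 0) (hN : 1 < N)
    (hk : IsMCPWeight K N D k) (hx : 0 < x) (hxD : x ≤ D / 2) (hβ : 1 ≤ β) (hβ' : β ≤ 3 / 2) :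
    k (β * x) ≤
      (1 + 2 * Real.cosh (Real.sqrt (-(K / (N - 1))) * D) * (β - 1)) ^ (N - 1) * k x ∧
    k x ≤
      (1 + 2 * Real.cosh (Real.sqrt (-(K / (N - 1))) * D) * (β - 1)) ^ (N - 1) * k (β * x) := by
  have hN1 : 0 < N - 1 := by linarith
  have hκ : K / (N - 1) ≤ 0 := div_nonpos_of_nonpos_of_nonneg hK hN1.le
  have hxβ : x ≤ β * x := by nlinarith
  have hβD : β * x < D := by nlinarith
  have hmono := hk.mono x (β * x) hx hxβ hβD
  have hanti := hk.anti x (β * x) hx hxβ hβD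
  have hkx := hk.pos x ⟨hx, by linarith⟩
  have hkβ := hk.pos (β * x) ⟨by linarith, hβD⟩
  simp only [leftModel] at hmono
  set κ := K / (N - 1)
  set L := Real.cosh (Real.sqrt (-κ) * D)
  have hL : 0 < L := Real.cosh_pos _
  have hb : 0 ≤ 1 + 2 * L * (β - 1) := by nlinarith
  have hsx := sK_pos hκ hx
  have hsDβ := sK_pos hκ (by linarith : 0 < D - β * x)
  have hsDx := sK_pos hκ (by linarith : 0 < D - x)
  have h1 : sK κ (β * x) ≤ (1 + 2 * L * (β - 1)) * sK κ x := by
    have e := sK_sub_le hκ hx.le hxβ hβD.le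
    have e2 := mul_le_mul_of_nonneg_left (self_le_sK hκ hx.le)
      (mul_nonneg hL.le (by linarith : 0 ≤ β - 1))
    have e3 : 0 ≤ L * (β - 1) * sK κ x := mul_nonneg (mul_nonneg hL.le (by linarith)) hsx.le
    nlinarith
  have h2 : sK κ (D - x) ≤ (1 + 2 * L * (β - 1)) * sK κ (D - β * x) := by
    have e := sK_sub_le hκ (by linarith : 0 ≤ D - β * x) (by linarith : D - β * x ≤ D - x)
      (by linarith : D - x ≤ D)
    -- From `x ≤ D/2` and `β ≤ 3/2` one gets `D - βx ≥ D/4 ≥ x/2`; this keeps the comparison away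
    -- from the endpoint `D` and is the source of the factor `2`.
    have e1 : x ≤ 2 * (D - β * x) := by nlinarith
    have e2 := mul_le_mul_of_nonneg_left
      (e1.trans (mul_le_mul_of_nonneg_left (self_le_sK hκ (by linarith : 0 ≤ D - β * x))
        zero_le_two)) (mul_nonneg hL.le (by linarith : 0 ≤ β - 1))
    nlinarith
  constructor
  · have h3 := Real.rpow_le_rpow (sK_pos hκ (by linarith : 0 < β * x)).le h1 hN1.le
    rw [Real.mul_rpow hb hsx.le] at h3
    have h4 := hanti.trans (mul_le_mul_of_nonneg_left h3 hkx.le)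
    have hpos : 0 < sK κ x ^ (N - 1) := Real.rpow_pos_of_pos hsx _
    refine le_of_mul_le_mul_right (h4.trans_eq ?_) hpos
    ring
  · have h3 := Real.rpow_le_rpow hsDx.le h2 hN1.le
    rw [Real.mul_rpow hb hsDβ.le] at h3
    have h4 := hmono.trans (mul_le_mul_of_nonneg_left h3 hkβ.le)
    have hpos : 0 < sK κ (D - β * x) ^ (N - 1) := Real.rpow_pos_of_pos hsDβ _
    refine le_of_mul_le_mul_right (h4.trans_eq ?_) hpos
    ring

/-- The inequality on `[0, D/2]` is applied to `x ↦ u(βx)`. The chain rule costs `β^p`, and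
replacing `k(x)` by `k(βx)` costs one factor `B` on each side. -/
theorem HalfPoincare.dilate {p K N D β μ μ' : ℝ} {k : ℝ → ℝ} (hp : 1 < p) (hK : K ≤ 0)
    (hN : 1 < N) (hD : 0 < D) (hk : IsMCPWeight K N D k) (hμ : 0 ≤ μ)
    (hβ : 1 ≤ β) (hβ' : β ≤ 3 / 2)
    (hμ' : μ' * (β ^ p *
      ((1 + 2 * Real.cosh (Real.sqrt (-(K / (N - 1))) * D) * (β - 1)) ^ (N - 1)) ^ 2) ≤ μ)
    (h : HalfPoincare p (D / 2) μ k) : HalfPoincare p (β * (D / 2)) μ' k := by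
  rintro u ⟨C, hu⟩ hua
  have hβ0 : 0 < β := by linarith
  have hL : 0 < D / 2 := by linarith
  have hp0 : 0 < p := by linarith
  set B := (1 + 2 * Real.cosh (Real.sqrt (-(K / (N - 1))) * D) * (β - 1)) ^ (N - 1) with hB
  have hB0 : 0 < B := by
    refine Real.rpow_pos_of_pos ?_ _
    have := Real.cosh_pos (Real.sqrt (-(K / (N - 1))) * D)
    nlinarith
  have hul : LipschitzWith (C * Real.toNNReal β) fun x => u (β * x) := by
    refine hu.comp (LipschitzWith.of_dist_le_mul fun x y => ?_)
    rw [Real.dist_eq, Real.dist_eq, ← mul_sub, abs_mul, abs_of_pos hβ0,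
      Real.coe_toNNReal _ hβ0.le]
  have key := h (fun x => u (β * x)) ⟨_, hul⟩ hua
  have hkL : IntervalIntegrable k volume 0 (D / 2) :=
    hk.intervalIntegrable le_rfl hL.le (by linarith)
  have hkβ : IntervalIntegrable k volume 0 (β * (D / 2)) :=
    hk.intervalIntegrable le_rfl (by positivity) (by nlinarith)
  have hUi := intervalIntegrable_rpow_mul hp0.le hu.continuous hkβ
  have hVi := intervalIntegrable_deriv_rpow_mul hp0.le hu hkβ
  have hUi' : IntervalIntegrable (fun x => |u (β * x)| ^ p * k (β * x)) volume 0 (D / 2) := by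
    have := hUi.comp_mul_left (c := β)
    simpa [mul_div_cancel_left₀ _ hβ0.ne'] using this
  have hVi' : IntervalIntegrable (fun x => |deriv u (β * x)| ^ p * k (β * x)) volume 0 (D / 2) := by
    have := hVi.comp_mul_left (c := β)
    simpa [mul_div_cancel_left₀ _ hβ0.ne'] using this
  have e1 : ∫ x in (0 : ℝ)..(D / 2), |u (β * x)| ^ p * k (β * x) =
      β⁻¹ * ∫ x in (0 : ℝ)..(β * (D / 2)), |u x| ^ p * k x := by
    have := intervalIntegral.integral_comp_mul_left (a := 0) (b := D / 2)
      (fun x => |u x| ^ p * k x) hβ0.ne'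
    simpa using this
  have e2 : ∫ x in (0 : ℝ)..(D / 2), |deriv u (β * x)| ^ p * k (β * x) =
      β⁻¹ * ∫ x in (0 : ℝ)..(β * (D / 2)), |deriv u x| ^ p * k x := by
    have := intervalIntegral.integral_comp_mul_left (a := 0) (b := D / 2)
      (fun x => |deriv u x| ^ p * k x) hβ0.ne'
    simpa using this
  have h1 : ∫ x in (0 : ℝ)..(D / 2), |u (β * x)| ^ p * k (β * x) ≤
      B * ∫ x in (0 : ℝ)..(D / 2), |u (β * x)| ^ p * k x := by
    rw [← intervalIntegral.integral_const_mul]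
    refine intervalIntegral.integral_mono_on_of_le_Ioo hL.le hUi'
      ((intervalIntegrable_rpow_mul hp0.le hul.continuous hkL).const_mul B) fun x hx => ?_
    have := (hk.dilation hK hN hx.1 hx.2.le hβ hβ').1
    rw [mul_left_comm]
    exact mul_le_mul_of_nonneg_left this (by positivity)
  have h2 : ∫ x in (0 : ℝ)..(D / 2), |deriv (fun x => u (β * x)) x| ^ p * k x ≤
      β ^ p * B * ∫ x in (0 : ℝ)..(D / 2), |deriv u (β * x)| ^ p * k (β * x) := by
    rw [← intervalIntegral.integral_const_mul]
    refine intervalIntegral.integral_mono_on_of_le_Ioo hL.le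
      (intervalIntegrable_deriv_rpow_mul hp0.le hul hkL) (hVi'.const_mul _) fun x hx => ?_
    have := (hk.dilation hK hN hx.1 hx.2.le hβ hβ').2
    rw [deriv_comp_mul_left, smul_eq_mul, abs_mul, abs_of_pos hβ0,
      Real.mul_rpow hβ0.le (abs_nonneg _)]
    calc β ^ p * |deriv u (β * x)| ^ p * k x ≤ β ^ p * |deriv u (β * x)| ^ p * (B * k (β * x)) :=
          mul_le_mul_of_nonneg_left this (by positivity)
      _ = _ := by ring
  rw [e1] at h1
  rw [e2] at h2
  have hU0 : 0 ≤ ∫ x in (0 : ℝ)..(β * (D / 2)), |u x| ^ p * k x := by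
    rw [intervalIntegral.integral_of_le (by positivity), integral_Ioc_eq_integral_Ioo]
    exact setIntegral_nonneg measurableSet_Ioo fun x hx => mul_nonneg (by positivity)
      (hk.pos x ⟨hx.1, by nlinarith [hx.2]⟩).le
  set U := ∫ x in (0 : ℝ)..(β * (D / 2)), |u x| ^ p * k x
  set V := ∫ x in (0 : ℝ)..(β * (D / 2)), |deriv u x| ^ p * k x
  have h3 : μ * (β⁻¹ * U) ≤ B * (β ^ p * B * (β⁻¹ * V)) := by
    calc μ * (β⁻¹ * U) ≤ μ * (B * ∫ x in (0 : ℝ)..(D / 2), |u (β * x)| ^ p * k x) :=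
          mul_le_mul_of_nonneg_left h1 hμ
      _ = B * (μ * ∫ x in (0 : ℝ)..(D / 2), |u (β * x)| ^ p * k x) := by ring
      _ ≤ _ := mul_le_mul_of_nonneg_left (key.trans h2) hB0.le
  have h4 : μ' * (β ^ p * B ^ 2) * (β⁻¹ * U) ≤ μ * (β⁻¹ * U) :=
    mul_le_mul_of_nonneg_right hμ' (by positivity)
  have h5 : 0 < β ^ p * B ^ 2 * β⁻¹ := by positivity
  refine le_of_mul_le_mul_left ?_ h5
  calc _ = μ' * (β ^ p * B ^ 2) * (β⁻¹ * U) := by ring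
    _ ≤ _ := h4.trans h3
    _ = _ := by ring

/-- A strict constant on `[0, D / 2]` persists on slightly longer intervals. -/
theorem HalfPoincare.exists_longer {p K N D lam μ : ℝ} {k : ℝ → ℝ} (hp : 1 < p) (hK : K ≤ 0)
    (hN : 1 < N) (hD : 0 < D) (hk : IsMCPWeight K N D k) (hlam : 0 < lam) (hμ : lam < μ)
    (h : HalfPoincare p (D / 2) μ k) :
    ∃ a ∈ Ioo (D / 2) D, ∃ μ', lam < μ' ∧ HalfPoincare p a μ' k := by
  obtain ⟨ν, hν, hνμ⟩ := exists_between hμ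
  -- The cost of a dilation is continuous in `β` and equals `1` at `β = 1`, so some `β > 1` still
  -- fits between `ν` and `μ`.
  have hcont : ContinuousAt (fun β : ℝ => ν * (β ^ p *
      ((1 + 2 * Real.cosh (Real.sqrt (-(K / (N - 1))) * D) * (β - 1)) ^ (N - 1)) ^ 2)) 1 := by
    refine continuousAt_const.mul ((continuousAt_id.rpow_const (Or.inl one_ne_zero)).mul
      (ContinuousAt.pow (ContinuousAt.rpow_const (by fun_prop) (Or.inr (by linarith))) 2))
  have hev := Filter.Tendsto.eventually_lt_const (u := μ) (by simpa using hνμ) hcont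
  have hev2 : ∀ᶠ β in nhdsWithin (1 : ℝ) (Ioi 1), β < 3 / 2 :=
    nhdsWithin_le_nhds (gt_mem_nhds (by norm_num))
  obtain ⟨β, ⟨hβ1, hβ2⟩, hβ3⟩ := ((hev.filter_mono nhdsWithin_le_nhds).and hev2 |>.and
    (self_mem_nhdsWithin : Ioi (1 : ℝ) ∈ nhdsWithin 1 (Ioi 1))).exists
  have hβ3' : 1 < β := hβ3
  exact ⟨β * (D / 2), ⟨by nlinarith, by nlinarith⟩, ν, hν,
    h.dilate hp hK hN hD hk (hlam.trans hμ).le hβ3'.le hβ2.le hβ1.le⟩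

/-! ### Regularity of MCP densities -/

theorem distortion_eq {κ t θ : ℝ} (hκ : κ ≤ 0) (hθ : 0 < θ) :
    distortion κ t θ = sK κ (t * θ) / sK κ θ := by
  unfold distortion sK
  rcases hκ.eq_or_lt with rfl | hlt
  · simp [mul_div_cancel_right₀ _ hθ.ne']
  · have hr : 0 < Real.sqrt (-κ) := Real.sqrt_pos.2 (by linarith)
    have h1 : κ * θ ^ 2 ≠ 0 := mul_ne_zero hlt.ne (by positivity)
    rw [if_neg h1, if_neg hlt.ne, if_neg hlt.ne, div_div_div_cancel_right₀ hr.ne',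
      mul_comm (t * θ), mul_comm θ]

theorem contraction_of_mem {K N D : ℝ} {h : ℝ → ℝ} (hK : K ≤ 0) (hN : 1 < N)
    (hh : h ∈ densityClass K N D) {x₀ x₁ s : ℝ} (h0 : x₀ ∈ Icc 0 D) (h1 : x₁ ∈ Icc 0 D)
    (hne : x₁ ≠ x₀) (hs : s ∈ Icc (0 : ℝ) 1) :
    h x₀ * sK (K / (N - 1)) (s * |x₁ - x₀|) ^ (N - 1) ≤
      h ((1 - s) * x₁ + s * x₀) * sK (K / (N - 1)) |x₁ - x₀| ^ (N - 1) := by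
  have hκ : K / (N - 1) ≤ 0 := div_nonpos_of_nonpos_of_nonneg hK (by linarith)
  have hθ : 0 < |x₁ - x₀| := abs_pos.2 (sub_ne_zero.2 hne)
  have hpos := sK_pos hκ hθ
  have hpos' : 0 ≤ sK (K / (N - 1)) (s * |x₁ - x₀|) :=
    (mul_nonneg hs.1 hθ.le).trans (self_le_sK hκ (mul_nonneg hs.1 hθ.le))
  have key := hh.1.contraction x₀ (hh.2 ▸ h0) x₁ (hh.2 ▸ h1) (1 - s)
    ⟨by linarith [hs.2], by linarith [hs.1]⟩
  rw [sub_sub_cancel, distortion_eq hκ hθ, Real.div_rpow hpos' hpos.le, div_mul_eq_mul_div,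
    div_le_iff₀ (Real.rpow_pos_of_pos hpos _)] at key
  linarith

/-- The contraction inequality from `y` towards the endpoint `0`, read at the intermediate point
`x`. -/
theorem density_anti {K N D : ℝ} {h : ℝ → ℝ} (hK : K ≤ 0) (hN : 1 < N)
    (hh : h ∈ densityClass K N D) {x y : ℝ} (hx : 0 < x) (hxy : x ≤ y) (hy : y < D) :
    h y * sK (K / (N - 1)) x ^ (N - 1) ≤ h x * sK (K / (N - 1)) y ^ (N - 1) := by
  have hy0 : 0 < y := hx.trans_le hxy
  have := contraction_of_mem hK hN hh (x₀ := y) (x₁ := 0) (s := x / y) ⟨hy0.le, hy.le⟩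
    ⟨le_rfl, by linarith⟩ hy0.ne ⟨by positivity, (div_le_one hy0).2 hxy⟩
  rwa [zero_sub, abs_neg, abs_of_pos hy0, mul_zero, zero_add, div_mul_cancel₀ _ hy0.ne'] at this

/-- The contraction inequality from `x` towards the endpoint `D`, read at the intermediate point
`y`. -/
theorem density_mono {K N D : ℝ} {h : ℝ → ℝ} (hK : K ≤ 0) (hN : 1 < N)
    (hh : h ∈ densityClass K N D) {x y : ℝ} (hx : 0 < x) (hxy : x ≤ y) (hy : y < D) :
    h x * leftModel K N D y ≤ h y * leftModel K N D x := by
  have hDx : 0 < D - x := by linarith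
  have := contraction_of_mem hK hN hh (x₀ := x) (x₁ := D) (s := (D - y) / (D - x))
    ⟨hx.le, by linarith⟩ ⟨by linarith, le_rfl⟩ (by linarith)
    ⟨div_nonneg (by linarith) hDx.le, (div_le_one hDx).2 (by linarith)⟩
  rwa [abs_of_pos hDx, div_mul_cancel₀ _ hDx.ne',
    show (1 - (D - y) / (D - x)) * D + (D - y) / (D - x) * x = y by field_simp; ring] at this

/-- The support condition supplies one interior point where `h > 0`; the two one-sided comparisons
propagate positivity to the left and to the right of it. -/
theorem density_pos {K N D : ℝ} {h : ℝ → ℝ} (hK : K ≤ 0) (hN : 1 < N) (hD : 0 < D)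
    (hh : h ∈ densityClass K N D) {y : ℝ} (hy : y ∈ Ioo 0 D) : 0 < h y := by
  have hκ : K / (N - 1) ≤ 0 := div_nonpos_of_nonpos_of_nonneg hK (by linarith)
  have hmid : D / 2 ∈ closure (Function.support h) := by
    have : D / 2 ∈ tsupport h := by rw [hh.2]; constructor <;> linarith
    exact this
  obtain ⟨z, hz, hz0⟩ := mem_closure_iff.1 hmid (Ioo 0 D) isOpen_Ioo ⟨by linarith, by linarith⟩
  have hhz : 0 < h z := lt_of_le_of_ne (hh.1.nonneg z) (Ne.symm hz0)
  rcases le_total y z with hle | hle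
  · have h1 := density_anti hK hN hh hy.1 hle hz.2
    have h2 : 0 < h y * sK (K / (N - 1)) z ^ (N - 1) :=
      (mul_pos hhz (Real.rpow_pos_of_pos (sK_pos hκ hy.1) _)).trans_le h1
    exact pos_of_mul_pos_left h2 (Real.rpow_nonneg (sK_pos hκ hz.1).le _)
  · have h1 := density_mono hK hN hh hz.1 hle hy.2
    have h2 := (mul_pos hhz (leftModel_pos hK hN hy.2)).trans_le h1
    exact pos_of_mul_pos_left h2 (leftModel_pos hK hN hz.2).le

/-- Near `y` the density is squeezed between the two model profiles normalized to take the value `h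
y` at `y`. -/
theorem density_continuousAt {K N D : ℝ} {h : ℝ → ℝ} (hK : K ≤ 0) (hN : 1 < N)
    (hh : h ∈ densityClass K N D) {y : ℝ} (hy : y ∈ Ioo 0 D) : ContinuousAt h y := by
  have hκ : K / (N - 1) ≤ 0 := div_nonpos_of_nonpos_of_nonneg hK (by linarith)
  set A : ℝ → ℝ := fun z => sK (K / (N - 1)) z ^ (N - 1) with hA
  have hApos : ∀ z, 0 < z → 0 < A z := fun z hz => Real.rpow_pos_of_pos (sK_pos hκ hz) _
  have hAc : Continuous A := (continuous_sK _).rpow_const fun _ => Or.inr (by linarith)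
  have hBpos : ∀ z, z < D → 0 < leftModel K N D z := fun z hz => leftModel_pos hK hN hz
  set F : ℝ → ℝ := fun z => h y * A z / A y with hF
  set G : ℝ → ℝ := fun z => h y * leftModel K N D z / leftModel K N D y with hG
  have hFt : Filter.Tendsto F (nhds y) (nhds (h y)) := by
    have : Continuous F := (continuous_const.mul hAc).div_const _
    have h1 := this.tendsto y
    rwa [show F y = h y from mul_div_cancel_right₀ _ (hApos y hy.1).ne'] at h1
  have hGt : Filter.Tendsto G (nhds y) (nhds (h y)) := by
    have : Continuous G := (continuous_const.mul (continuous_leftModel hN)).div_const _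
    have h1 := this.tendsto y
    rwa [show G y = h y from mul_div_cancel_right₀ _ (hBpos y hy.2).ne'] at h1
  have hmin := hFt.min hGt
  have hmax := hFt.max hGt
  rw [min_self] at hmin
  rw [max_self] at hmax
  have hnh : Ioo 0 D ∈ nhds y := Ioo_mem_nhds hy.1 hy.2
  refine tendsto_of_tendsto_of_tendsto_of_le_of_le' hmin hmax ?_ ?_
  · filter_upwards [hnh] with z hz
    rcases le_total y z with hle | hle
    · refine (min_le_right _ _).trans ?_
      rw [hG]
      simp only
      rw [div_le_iff₀ (hBpos y hy.2)]
      exact density_mono hK hN hh hy.1 hle hz.2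
    · refine (min_le_left _ _).trans ?_
      rw [hF]
      simp only
      rw [div_le_iff₀ (hApos y hy.1)]
      exact density_anti hK hN hh hz.1 hle hy.2
  · filter_upwards [hnh] with z hz
    rcases le_total y z with hle | hle
    · refine le_trans ?_ (le_max_left _ _)
      rw [hF]
      simp only
      rw [le_div_iff₀ (hApos y hy.1)]
      exact density_anti hK hN hh hy.1 hle hz.2
    · refine le_trans ?_ (le_max_right _ _)
      rw [hG]
      simp only
      rw [le_div_iff₀ (hBpos y hy.2)]
      exact density_mono hK hN hh hz.1 hle hy.2

theorem isMCPWeight_of_mem {K N D : ℝ} {h : ℝ → ℝ} (hK : K ≤ 0) (hN : 1 < N) (hD : 0 < D)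
    (hh : h ∈ densityClass K N D) : IsMCPWeight K N D h where
  pos _ hx := density_pos hK hN hD hh hx
  cont _ hx := (density_continuousAt hK hN hh hx).continuousWithinAt
  integrable := hh.1.integrable.intervalIntegrable
  mono _ _ hx hxy hy := density_mono hK hN hh hx hxy hy
  anti _ _ hx hxy hy := density_anti hK hN hh hx hxy hy

/-- Reflection exchanges the two monotonicity conditions, so every statement about the left half
also serves the right half. -/
theorem IsMCPWeight.reflect {K N D : ℝ} {k : ℝ → ℝ} (hk : IsMCPWeight K N D k) :
    IsMCPWeight K N D fun x => k (D - x) where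
  pos x hx := hk.pos _ ⟨by linarith [hx.2], by linarith [hx.1]⟩
  cont := hk.cont.comp (continuous_const.sub continuous_id).continuousOn
    fun x hx => ⟨by simpa using hx.2, by simpa using hx.1⟩
  integrable := by simpa using (hk.integrable.comp_sub_left D).symm
  mono x y hx hxy hy := hk.anti (D - y) (D - x) (by linarith) (by linarith) (by linarith)
  anti x y hx hxy hy := by
    have := hk.mono (D - y) (D - x) (by linarith) (by linarith) (by linarith)
    simpa [leftModel] using this

/-! ### Lower bounds for the spectral gap -/

/-- For `p < 2` the factor `|t|^{p-2}` is singular at `0`; the product is continuous because it is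
`1/p` times the derivative of the `C¹` function `|t|^p`. -/
theorem continuous_mul_abs_rpow {p : ℝ} (hp : 1 < p) :
    Continuous fun t : ℝ => t * |t| ^ (p - 2) := by
  have h1 : Continuous (deriv fun t : ℝ => |t| ^ p) :=
    (contDiff_norm_rpow (E := ℝ) hp).continuous_deriv le_rfl
  have h2 : (fun t : ℝ => t * |t| ^ (p - 2)) = fun t => deriv (fun t : ℝ => |t| ^ p) t / p := by
    ext t
    rw [(hasDerivAt_abs_rpow t hp).deriv]
    field_simp
  rw [h2]
  exact h1.div_const p

theorem abs_mul_abs_rpow {p : ℝ} (hp : 1 < p) (t : ℝ) :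
    |t * |t| ^ (p - 2)| = |t| ^ (p - 1) := by
  rw [abs_mul, abs_of_nonneg (by positivity : 0 ≤ |t| ^ (p - 2))]
  rcases (abs_nonneg t).eq_or_lt with h | h
  · rw [← h, zero_mul, Real.zero_rpow (by linarith)]
  · rw [show p - 1 = p - 2 + 1 by ring, Real.rpow_add_one h.ne', mul_comm]

/-- The tangent line inequality for `|·|^p`. -/
theorem abs_rpow_le_abs_sub_rpow {p : ℝ} (hp : 1 < p) (t c : ℝ) :
    |t| ^ p ≤ |t - c| ^ p + p * c * (t * |t| ^ (p - 2)) := by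
  have hp0 : 0 < p := by linarith
  have hp1 : 0 < p - 1 := by linarith
  -- Young's inequality bounds `(t - c) t|t|^{p-2}` by `|t - c|^p / p + (p - 1)|t|^p / p`, while `t
  -- · t|t|^{p-2} = |t|^p`.
  have hy := Real.young_inequality_of_nonneg (abs_nonneg (t - c))
    (by positivity : 0 ≤ |t| ^ (p - 1)) (Real.HolderConjugate.conjExponent hp)
  rw [← Real.rpow_mul (abs_nonneg t), show p.conjExponent = p / (p - 1) from rfl,
    mul_div_cancel₀ _ hp1.ne'] at hy
  have h1 : (t - c) * (t * |t| ^ (p - 2)) ≤ |t - c| * |t| ^ (p - 1) := by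
    rw [← abs_mul_abs_rpow hp t, ← abs_mul]
    exact le_abs_self _
  have h2 : t * (t * |t| ^ (p - 2)) = |t| ^ p := by
    rcases eq_or_ne t 0 with rfl | h
    · simp [Real.zero_rpow hp0.ne']
    · rw [← mul_assoc, ← abs_mul_abs_self t, show p = p - 2 + 1 + 1 by ring,
        Real.rpow_add_one (abs_ne_zero.2 h), Real.rpow_add_one (abs_ne_zero.2 h)]
      ring_nf
  have h3 : |t - c| * |t| ^ (p - 1) * p ≤ |t - c| ^ p + (p - 1) * |t| ^ p := by
    have := mul_le_mul_of_nonneg_right hy hp0.le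
    refine this.trans_eq ?_
    field_simp
  nlinarith

theorem integral_mul_density {K N D : ℝ} {h : ℝ → ℝ} (hD : 0 < D)
    (hh : h ∈ densityClass K N D) (g : ℝ → ℝ) :
    ∫ x, g x * h x = ∫ x in (0 : ℝ)..D, g x * h x := by
  rw [intervalIntegral.integral_of_le hD.le, ← integral_Icc_eq_integral_Ioc]
  refine (setIntegral_eq_integral_of_forall_compl_eq_zero fun x hx => ?_).symm
  rw [← hh.2] at hx
  rw [image_eq_zero_of_notMem_tsupport hx, mul_zero]

/-- There are admissible functions in the definition of the spectral gap. -/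
theorem exists_admissible {p K N D : ℝ} {h : ℝ → ℝ} (hp : 1 < p) (hD : 0 < D)
    (hh : h ∈ densityClass K N D) :
    ∃ u : ℝ → ℝ, (∃ C, LipschitzWith C u) ∧ Integrable (fun x => |u x| ^ p * h x) ∧
      ∫ x, u x * |u x| ^ (p - 2) * h x = 0 ∧ ∃ x ∈ tsupport h, u x ≠ 0 := by
  have hp1 : 0 < p - 1 := by linarith
  have hψ := continuous_mul_abs_rpow hp
  have hint : IntervalIntegrable h volume 0 D := hh.1.integrable.intervalIntegrable
  -- The witness is `u(x) = x - c`, with `c ∈ [0, D]` found by the intermediate value theorem.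
  -- Nonemptiness matters because the real infimum of the empty set is `0`, which would spoil a
  -- lower bound.
  have hcont : ContinuousOn (fun c => ∫ x in (0 : ℝ)..D, (x - c) * |x - c| ^ (p - 2) * h x)
      (Icc 0 D) := by
    intro c _
    refine intervalIntegral.continuousWithinAt_of_dominated_interval
      (bound := fun x => D ^ (p - 1) * h x) (Filter.Eventually.of_forall fun c => ?_)
      (Filter.eventually_of_mem self_mem_nhdsWithin fun c hc =>
        Filter.Eventually.of_forall fun x hx => ?_) (hint.const_mul _)
      (Filter.Eventually.of_forall fun x _ => ?_)
    · exact ((hψ.comp (continuous_id.sub continuous_const)).measurable.mul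
        hh.1.measurable).aestronglyMeasurable
    · rw [uIoc_of_le hD.le] at hx
      rw [norm_mul, Real.norm_of_nonneg (hh.1.nonneg x), Real.norm_eq_abs, abs_mul_abs_rpow hp]
      refine mul_le_mul_of_nonneg_right (Real.rpow_le_rpow (abs_nonneg _) ?_ hp1.le)
        (hh.1.nonneg x)
      exact abs_le.2 ⟨by linarith [hx.1, hc.2], by linarith [hx.2, hc.1]⟩
    · exact ((hψ.comp (continuous_const.sub continuous_id)).mul
        continuous_const).continuousWithinAt
  have h0 : 0 ≤ ∫ x in (0 : ℝ)..D, (x - 0) * |x - 0| ^ (p - 2) * h x :=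
    intervalIntegral.integral_nonneg hD.le fun x hx => by
      rw [sub_zero]
      exact mul_nonneg (mul_nonneg hx.1 (by positivity)) (hh.1.nonneg x)
  have h1 : ∫ x in (0 : ℝ)..D, (x - D) * |x - D| ^ (p - 2) * h x ≤ 0 := by
    rw [intervalIntegral.integral_of_le hD.le]
    exact setIntegral_nonpos measurableSet_Ioc fun x hx =>
      mul_nonpos_of_nonpos_of_nonneg (mul_nonpos_of_nonpos_of_nonneg (by linarith [hx.2])
        (by positivity)) (hh.1.nonneg x)
  obtain ⟨c, hc, hc0⟩ := intermediate_value_Icc' hD.le hcont ⟨h1, h0⟩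
  refine ⟨fun x => x - c, ⟨1, LipschitzWith.of_dist_le_mul fun x y => ?_⟩, ?_, ?_, ?_⟩
  · simp [Real.dist_eq]
  · have : Function.support (fun x => |x - c| ^ p * h x) ⊆ Icc 0 D := fun x hx => by
      rw [← hh.2]
      exact subset_tsupport _ (right_ne_zero_of_mul hx)
    rw [← integrableOn_iff_integrable_of_support_subset this]
    exact hh.1.integrable.integrableOn.continuousOn_mul
      ((continuous_id.sub continuous_const).abs.rpow_const fun _ => Or.inr (by linarith)).continuousOn
      isCompact_Icc
  · rw [integral_mul_density hD hh]
    exact hc0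
  · rw [hh.2]
    by_cases hcz : c = 0
    · exact ⟨D, ⟨hD.le, le_rfl⟩, by simp [hcz, hD.ne']⟩
    · exact ⟨0, ⟨le_rfl, hD.le⟩, by simpa using hcz⟩

theorem HalfPoincare.mono {p a μ μ' : ℝ} {k : ℝ → ℝ} (ha : 0 ≤ a) (hk : ∀ x ∈ Ioo 0 a, 0 ≤ k x)
    (hμ : μ' ≤ μ) (h : HalfPoincare p a μ k) : HalfPoincare p a μ' k := by
  intro u hu hua
  refine (mul_le_mul_of_nonneg_right hμ ?_).trans (h u hu hua)
  rw [intervalIntegral.integral_of_le ha, integral_Ioc_eq_integral_Ioo]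
  exact setIntegral_nonneg measurableSet_Ioo fun x hx => mul_nonneg (by positivity) (hk x hx)

/-- Poincaré inequalities on both sides of a splitting point bound the spectral gap. -/
theorem le_spectralGap {p K N D a μ : ℝ} {h : ℝ → ℝ} (hp : 1 < p) (hK : K ≤ 0) (hN : 1 < N)
    (hD : 0 < D) (hh : h ∈ densityClass K N D) (hμ : 0 ≤ μ)
    (hl : HalfPoincare p a μ h) (hr : HalfPoincare p (D - a) μ fun x => h (D - x)) :
    μ ≤ spectralGap p h := by
  have hp0 : 0 < p := by linarith
  obtain ⟨v, hv1, hv2, hv3, hv4⟩ := exists_admissible hp hD hh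
  refine le_csInf ⟨_, v, hv1, hv2, hv3, hv4, rfl⟩ ?_
  rintro r ⟨u, ⟨C, hu⟩, hui, hu0, ⟨z, hz, huz⟩, rfl⟩
  have hnonneg : ∀ x, 0 ≤ |u x| ^ p * h x := fun x => mul_nonneg (by positivity) (hh.1.nonneg x)
  have hpos : 0 < ∫ x, |u x| ^ p * h x := by
    rw [integral_pos_iff_support_of_nonneg hnonneg hui]
    have hopen : IsOpen ({x | u x ≠ 0} ∩ Ioo 0 D) :=
      (isOpen_ne_fun hu.continuous continuous_const).inter isOpen_Ioo
    -- The point where `u ≠ 0` may be an endpoint; continuity moves it into the open interval, where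
    -- `h > 0`.
    have hne : ({x | u x ≠ 0} ∩ Ioo 0 D).Nonempty := by
      rw [hh.2, ← closure_Ioo hD.ne] at hz
      exact mem_closure_iff.1 hz _ (isOpen_ne_fun hu.continuous continuous_const) huz
    refine (hopen.measure_pos volume hne).trans_le (measure_mono fun x hx => ?_)
    have h1 := density_pos hK hN hD hh hx.2
    have h2 : 0 < |u x| := abs_pos.2 hx.1
    exact (mul_pos (Real.rpow_pos_of_pos h2 p) h1).ne'
  rw [le_div_iff₀ hpos]
  have hint : ∀ b c, IntervalIntegrable h volume b c := fun b c =>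
    hh.1.integrable.intervalIntegrable
  -- Subtracting `u(a)` lets the splitting point `a` be fixed in advance, independently of the zeros
  -- of `u`. In the tangent line inequality at `u`, the linear term integrates to `0` by the
  -- constraint.
  set w : ℝ → ℝ := fun x => u x - u a with hw
  have hwL : LipschitzWith C w := LipschitzWith.of_dist_le_mul fun x y => by
    have := hu.dist_le_mul x y
    simpa [hw, Real.dist_eq] using this
  have hwd : deriv w = deriv u := by ext x; rw [hw]; exact deriv_sub_const _
  have hwi : ∀ b c, IntervalIntegrable (fun x => |w x| ^ p * h x) volume b c := fun b c =>
    intervalIntegrable_rpow_mul hp0.le hwL.continuous (hint b c)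
  have hdi : ∀ b c, IntervalIntegrable (fun x => |deriv u x| ^ p * h x) volume b c := fun b c =>
    intervalIntegrable_deriv_rpow_mul hp0.le hu (hint b c)
  have hψi : IntervalIntegrable (fun x => u x * |u x| ^ (p - 2) * h x) volume 0 D :=
    (hint 0 D).continuousOn_mul ((continuous_mul_abs_rpow hp).comp hu.continuous).continuousOn
  have h1 : ∫ x in (0 : ℝ)..D, |u x| ^ p * h x ≤ ∫ x in (0 : ℝ)..D, |w x| ^ p * h x := by
    have hle : ∫ x in (0 : ℝ)..D, |u x| ^ p * h x ≤ ∫ x in (0 : ℝ)..D,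
        (|w x| ^ p * h x + p * u a * (u x * |u x| ^ (p - 2) * h x)) := by
      refine intervalIntegral.integral_mono_on hD.le
        (intervalIntegrable_rpow_mul hp0.le hu.continuous (hint 0 D))
        ((hwi 0 D).add (hψi.const_mul _)) fun x _ => ?_
      have := mul_le_mul_of_nonneg_right (abs_rpow_le_abs_sub_rpow hp (u x) (u a)) (hh.1.nonneg x)
      rw [hw]
      simp only
      linarith
    rw [intervalIntegral.integral_add (hwi 0 D) (hψi.const_mul _),
      intervalIntegral.integral_const_mul,
      ← integral_mul_density hD hh fun x => u x * |u x| ^ (p - 2), hu0] at hle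
    linarith
  have hleft := hl w ⟨C, hwL⟩ (by simp [hw])
  have hright := hr (fun x => w (D - x)) ⟨C, LipschitzWith.of_dist_le_mul fun x y => by
    have := hwL.dist_le_mul (D - x) (D - y)
    rwa [dist_sub_left] at this⟩ (by simp [hw])
  have e1 : ∫ x in (0 : ℝ)..(D - a), |w (D - x)| ^ p * h (D - x) =
      ∫ x in a..D, |w x| ^ p * h x := by
    have := intervalIntegral.integral_comp_sub_left (a := 0) (b := D - a)
      (fun x => |w x| ^ p * h x) D
    simpa using this
  have e2 : ∫ x in (0 : ℝ)..(D - a), |deriv (fun x => w (D - x)) x| ^ p * h (D - x) =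
      ∫ x in a..D, |deriv u x| ^ p * h x := by
    have := intervalIntegral.integral_comp_sub_left (a := 0) (b := D - a)
      (fun x => |deriv u x| ^ p * h x) D
    simpa [deriv_comp_const_sub, hwd] using this
  rw [e1, e2] at hright
  rw [hwd] at hleft
  have s1 := intervalIntegral.integral_add_adjacent_intervals (hwi 0 a) (hwi a D)
  have s2 := intervalIntegral.integral_add_adjacent_intervals (hdi 0 a) (hdi a D)
  rw [integral_mul_density hD hh, integral_mul_density hD hh]
  calc μ * ∫ x in (0 : ℝ)..D, |u x| ^ p * h x ≤ μ * ∫ x in (0 : ℝ)..D, |w x| ^ p * h x :=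
        mul_le_mul_of_nonneg_left h1 hμ
    _ ≤ _ := by rw [← s1, ← s2]; linarith

/-! ### Rigidity -/

/-- At `a = D/2` only the left side is known to be strict. Moving the splitting point slightly to
the right spends part of that margin and makes the right interval shorter than `D/2`, hence strict
too. -/
theorem exists_split_of_gain {p K N D lam τ τ' : ℝ} {k f : ℝ → ℝ} (hp : 1 < p)
    (hK : K ≤ 0) (hN : 1 < N) (hD : 0 < D) (hlam : 0 < lam)
    (hf : IsModelEigenfunction p K N D lam f) (hk : IsMCPWeight K N D k)
    (hτ : 0 < τ) (hττ' : τ < τ') (hτ' : τ' < D / 2)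
    (hlt : k τ / leftModel K N D τ < k τ' / leftModel K N D τ') :
    ∃ a μ, lam < μ ∧ HalfPoincare p a μ k ∧
      HalfPoincare p (D - a) μ fun x => k (D - x) := by
  obtain ⟨μ, hμ, h1⟩ := exists_halfPoincare_of_gain hp hK hN hD hlam hf hk hτ hττ' hτ' hlt
  obtain ⟨a, ha, μ₁, hμ₁, h2⟩ := h1.exists_longer hp hK hN hD hk hlam hμ
  obtain ⟨μ₂, hμ₂, h3⟩ := exists_halfPoincare_of_lt hp hK hN hD hlam hf hk.reflect
    (by linarith [ha.2] : 0 < D - a) (by linarith [ha.1])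
  refine ⟨a, min μ₁ μ₂, lt_min hμ₁ hμ₂,
    h2.mono (by linarith [ha.1]) (fun x hx => (hk.pos x ⟨hx.1, hx.2.trans ha.2⟩).le)
      (min_le_left _ _),
    h3.mono (by linarith [ha.2]) (fun x hx => (hk.reflect.pos x
      ⟨hx.1, by linarith [hx.2, ha.1]⟩).le) (min_le_right _ _)⟩

/-- A nondecreasing ratio that never increases strictly is constant. Continuity extends the identity
to `D/2`, where the left and right constants will be compared. -/
theorem IsMCPWeight.eq_mul_leftModel {K N D : ℝ} {k : ℝ → ℝ} (hK : K ≤ 0) (hN : 1 < N)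
    (hD : 0 < D) (hk : IsMCPWeight K N D k)
    (hgain : ∀ τ τ', 0 < τ → τ < τ' → τ' < D / 2 →
      ¬k τ / leftModel K N D τ < k τ' / leftModel K N D τ') :
    ∃ c > 0, ∀ x ∈ Ioc 0 (D / 2), k x = c * leftModel K N D x := by
  have hmpos : ∀ x, x < D → 0 < leftModel K N D x := fun x hx => leftModel_pos hK hN hx
  have hle : ∀ x y, 0 < x → x < y → y < D / 2 →
      k x / leftModel K N D x = k y / leftModel K N D y := by
    intro x y hx hxy hy
    refine le_antisymm ?_ (not_lt.1 (hgain x y hx hxy hy))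
    rw [div_le_div_iff₀ (hmpos x (by linarith)) (hmpos y (by linarith))]
    exact hk.mono x y hx hxy.le (by linarith)
  refine ⟨k (D / 4) / leftModel K N D (D / 4),
    div_pos (hk.pos _ ⟨by linarith, by linarith⟩) (hmpos _ (by linarith)), ?_⟩
  have heq : EqOn k (fun x => k (D / 4) / leftModel K N D (D / 4) * leftModel K N D x)
      (Ioo 0 (D / 2)) := by
    intro x hx
    beta_reduce
    rw [← div_eq_iff (hmpos x (by linarith [hx.2])).ne']
    rcases lt_trichotomy x (D / 4) with h | h | h
    · exact hle x _ hx.1 h (by linarith)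
    · rw [h]
    · exact (hle _ x (by linarith) h hx.2).symm
  exact heq.of_subset_closure
    (hk.cont.mono fun x hx => ⟨hx.1, by linarith [hx.2]⟩)
    (continuous_const.mul (continuous_leftModel hN)).continuousOn Ioo_subset_Ioc_self
    (by rw [closure_Ioo (by linarith)]; exact Ioc_subset_Icc_self)

end MCPGap

theorem theorem3p11 (p K N D : ℝ) (hp : 1 < p) (hK : K ≤ 0) (hN : 1 < N) (hD : 0 < D)
    (h : ℝ → ℝ) (hh : h ∈ MCPGap.densityClass K N D)
    (hgap : MCPGap.spectralGap p h = MCPGap.modelGap p K N D) :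
    ∃ c : ℝ, 0 < c ∧ ∀ x ∈ Set.Ioo 0 D, h x = c * MCPGap.modelDensity K N D x := by
  obtain ⟨lam, hlam, hφ, f, hf⟩ := MCPGap.exists_model_eigenfunction hp hK hN hD
  have hf' : MCPGap.IsModelEigenfunction p K N D lam f := ⟨hf.1, hf.2.1, hf.2.2⟩
  have hw := MCPGap.isMCPWeight_of_mem hK hN hD hh
  -- Only this inequality is needed: a gap strictly above `lam` already exceeds `modelGap`.
  have hmodel : MCPGap.modelGap p K N D ≤ lam :=
    csInf_le ⟨0, fun r hr => hr.1⟩ ⟨hlam.le, hφ⟩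
  have hno : ∀ a μ, lam < μ → MCPGap.HalfPoincare p a μ h →
      MCPGap.HalfPoincare p (D - a) μ (fun x => h (D - x)) → False := by
    intro a μ hμ h1 h2
    have := MCPGap.le_spectralGap hp hK hN hD hh (hlam.trans hμ).le h1 h2
    linarith
  obtain ⟨c, hc, hcl⟩ := hw.eq_mul_leftModel hK hN hD fun τ τ' h1 h2 h3 hlt => by
    obtain ⟨a, μ, hμ, hl, hr⟩ :=
      MCPGap.exists_split_of_gain hp hK hN hD hlam hf' hw h1 h2 h3 hlt
    exact hno a μ hμ hl hr
  obtain ⟨c', _, hcr⟩ := hw.reflect.eq_mul_leftModel hK hN hD fun τ τ' h1 h2 h3 hlt => by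
    obtain ⟨a, μ, hμ, hl, hr⟩ :=
      MCPGap.exists_split_of_gain hp hK hN hD hlam hf' hw.reflect h1 h2 h3 hlt
    -- The splitting point `a` belongs to the reflected density; for `h` itself it is `D - a`, and
    -- the two one-sided inequalities trade places.
    refine hno (D - a) μ hμ (by simpa using hr) ?_
    simpa using hl
  have hmid : D / 2 ∈ Ioc 0 (D / 2) := ⟨by linarith, le_rfl⟩
  have hcc : c' = c := by
    have h1 := hcl _ hmid
    have h2 := hcr _ hmid
    rw [show D - D / 2 = D / 2 by ring, h1] at h2
    exact (mul_right_cancel₀ (MCPGap.leftModel_pos hK hN (by linarith : D / 2 < D)).ne' h2).symm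
  refine ⟨c, hc, fun x hx => ?_⟩
  unfold MCPGap.modelDensity
  by_cases hx2 : x ≤ D / 2
  · rw [if_pos ⟨hx.1.le, hx2⟩]
    exact hcl x ⟨hx.1, hx2⟩
  · rw [if_neg fun hcon => hx2 hcon.2, if_pos ⟨(not_le.1 hx2).le, hx.2.le⟩]
    have := hcr (D - x) ⟨by linarith [hx.2], by linarith [not_le.1 hx2]⟩
    rw [sub_sub_cancel, MCPGap.leftModel, sub_sub_cancel, hcc] at this
    exact this
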